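/- Let $H^2\subset L^2(\mathbb T)$ be the Hardy space (functions whose negative Fourier coefficients vanish; $\mathbb T$ carries normalised Lebesgue measure), $H^2_0=zH^2$, and call $\theta\in H^2$ inner if $|\theta|=1$ a.e. on $\mathbb T$; $\theta(0)$ denotes the zeroth Fourier coefficient of $\theta$. For inner $\theta$ let $K_\theta=H^2\ominus\theta H^2$, let $K_\theta^\perp$ be its orthogonal complement in $L^2(\mathbb T)$, so that $K_\theta^\perp=\overline{H^2_0}\oplus\theta H^2$, and let $U_\theta:K_\theta^\perp\to K_\theta^\perp$, $U_\theta h=(I-P_\theta)(zh)$, be the dual of the compressed shift, where $P_\theta$ is the orthogonal projection of $L^2(\mathbb T)$ onto $K_\theta$. A closed subspace $\mathcal M\subseteq K_\theta^\perp$ is nearly $U_\theta^*$-invariant if $U_\theta^*\bigl(\mathcal M\cap U_\theta K_\theta^\perp\bigr)\subseteq\mathcal M$. **Corollary 3.6.** Let $\theta$ be an inner function with $\theta(0)=0$, and let $\mathcal M\subseteq K_\theta^\perp$ be a closed nearly $U_\theta^*$-invariant subspace of the form $\mathcal M=\mathcal M_-\oplus\mathcal M_+$, where $\mathcal M_-$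 is a closed subspace of $\overline{H^2_0}$ and $\mathcal M_+$ is a closed subspace of $\theta H^2$. Then 1. $\mathcal M_-$ is $\{0\}$, or $\overline{H_0^2}$, or $\overline{\alpha H_0^2}$ for some inner function $\alpha$; and 2. $\mathcal M_+$ is $\{0\}$, or $\theta H^2$, or $GK_\beta=\{Gk:k\in K_\beta\}$ for some inner function $\beta$, or $\gamma\theta H^2$ for some inner function $\gamma$ with $\gamma(0)\neq0$. Here $G\in\theta H^2$ is the unit vector in $\mathcal M\ominus(\mathcal M\cap\{\theta\}^\perp)$ with $\langle G,\theta\rangle>0$ (and $GK_\beta\subseteq L^2(\mathbb T)$). -/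

import Mathlib

open MeasureTheory AddCircle
open scoped ENNReal ComplexConjugate

noncomputable section

namespace DualShift

/-- The unit circle, parametrised by `t ↦ e^{2πit}` on `ℝ / ℤ`. -/
abbrev Torus : Type := AddCircle (1 : ℝ)

/-- Normalised Lebesgue measure on the circle. -/
abbrev haarT : Measure Torus := haarAddCircle

/-- The Hilbert space `L²(𝕋)`. -/
abbrev L2 : Type := Lp ℂ 2 haarT

/-- The Hardy space `H²`: the functions in `L²(𝕋)` whose negative Fourier coefficients vanish. -/
def hardy : Submodule ℂ L2 where
  carrier := {f | ∀ n : ℤ, n < 0 → fourierCoeff (f : Torus → ℂ) n = 0}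
  zero_mem' := fun n _ => by rw [← fourierBasis_repr]; simp
  add_mem' := fun {f g} hf hg n hn => by
    rw [← fourierBasis_repr, map_add, lp.coeFn_add, Pi.add_apply, fourierBasis_repr,
      fourierBasis_repr, hf n hn, hg n hn, add_zero]
  smul_mem' := fun c f hf n hn => by
    rw [← fourierBasis_repr, map_smul, lp.coeFn_smul, Pi.smul_apply, fourierBasis_repr, hf n hn,
      smul_zero]

/-- An inner function, given by its boundary values: an element of `H²` of modulus one almost
everywhere on the circle. -/
def IsInner (θ : L2) : Prop :=
  θ ∈ hardy ∧ ∀ᵐ t ∂haarT, ‖θ t‖ = 1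

/-- The value `f(0)` at the centre of the disk of (the analytic extension of) `f ∈ H²`, that is,
the zeroth Fourier coefficient of `f`. -/
def valueAtZero (f : L2) : ℂ := fourierCoeff (f : Torus → ℂ) 0

/-- `φN`: the square integrable functions of the form `φk` with `k ∈ N` (if `φ` is bounded, every
product `φk` is square integrable). -/
def mulSpace (φ : L2) (N : Submodule ℂ L2) : Submodule ℂ L2 where
  carrier := {f | ∃ k ∈ N, ∀ᵐ t ∂haarT, f t = φ t * k t}
  zero_mem' := ⟨0, N.zero_mem, by simp⟩
  add_mem' := by
    rintro f g ⟨k, hk, hfk⟩ ⟨l, hl, hgl⟩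
    refine ⟨k + l, N.add_mem hk hl, ?_⟩
    filter_upwards [hfk, hgl, Lp.coeFn_add f g, Lp.coeFn_add k l] with t h1 h2 h3 h4
    rw [h3, h4, Pi.add_apply, Pi.add_apply, h1, h2, mul_add]
  smul_mem' := by
    rintro c f ⟨k, hk, hfk⟩
    refine ⟨c • k, N.smul_mem c hk, ?_⟩
    filter_upwards [hfk, Lp.coeFn_smul c f, Lp.coeFn_smul c k] with t h1 h2 h3
    rw [h2, h3, Pi.smul_apply, Pi.smul_apply, h1, smul_eq_mul, smul_eq_mul, mul_left_comm]

/-- The space `{k̄ : k ∈ N}` of complex conjugates of the functions in `N`. -/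
def conjSpace (N : Submodule ℂ L2) : Submodule ℂ L2 where
  carrier := {f | ∃ k ∈ N, ∀ᵐ t ∂haarT, f t = conj (k t)}
  zero_mem' := ⟨0, N.zero_mem, by simp⟩
  add_mem' := by
    rintro f g ⟨k, hk, hfk⟩ ⟨l, hl, hgl⟩
    refine ⟨k + l, N.add_mem hk hl, ?_⟩
    filter_upwards [hfk, hgl, Lp.coeFn_add f g, Lp.coeFn_add k l] with t h1 h2 h3 h4
    rw [h3, h4, Pi.add_apply, Pi.add_apply, h1, h2, map_add]
  smul_mem' := by
    rintro c f ⟨k, hk, hfk⟩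
    refine ⟨conj c • k, N.smul_mem _ hk, ?_⟩
    filter_upwards [hfk, Lp.coeFn_smul c f, Lp.coeFn_smul (conj c) k] with t h1 h2 h3
    rw [h2, h3, Pi.smul_apply, Pi.smul_apply, h1, smul_eq_mul, smul_eq_mul, map_mul,
      Complex.conj_conj]

/-- `H₀² = zH²`. -/
def hardyZero : Submodule ℂ L2 := mulSpace (fourierLp 2 1) hardy

/-- The model space `K_θ = H² ⊖ θH²`. -/
def modelSpace (θ : L2) : Submodule ℂ L2 := hardy ⊓ (mulSpace θ hardy)ᗮ

/-- Multiplication by `z` on `L²(𝕋)`, the bilateral shift. -/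
def mulZ : L2 →L[ℂ] L2 := (ContinuousLinearMap.mul ℂ ℂ).holderL haarT ∞ 2 2 (fourierLp ∞ 1 : Lp ℂ ∞ haarT)

/-- The dual of the compressed shift on `K_θ^⊥` (complement in `L²(𝕋)`): `U_θ h` is the orthogonal
projection of `zh` to `K_θ^⊥`. -/
def dualShift (θ : L2) : (modelSpace θ)ᗮ →L[ℂ] (modelSpace θ)ᗮ :=
  ((modelSpace θ)ᗮ.orthogonalProjectionOnto ∘L mulZ) ∘L (modelSpace θ)ᗮ.subtypeL

/-- A closed subspace `F` of a Hilbert space `H` is nearly `T`-invariant if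
`T (F ∩ T^* H) ⊆ F`. -/
def IsNearlyInvariant {H : Type*} [NormedAddCommGroup H] [InnerProductSpace ℂ H] [CompleteSpace H]
    (T : H →L[ℂ] H) (F : Submodule ℂ H) : Prop :=
  IsClosed (F : Set H) ∧
    ∀ x ∈ F, x ∈ Set.range (ContinuousLinearMap.adjoint T) → T x ∈ F

end DualShift

end

open MeasureTheory AddCircle
open scoped ENNReal ComplexConjugate

noncomputable section

namespace DualShift

/-! ### Contractions on a Hilbert space and their rank-one deflations. -/

section Contraction

open Filter Topology

variable {H : Type*} [NormedAddCommGroup H] [InnerProductSpace ℂ H]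

/-! If `f` and `z̄f` both lie in `K_θ^⊥`, then `U_θ (z̄f) = f` and `U_θ^* f = z̄f`. Near invariance
therefore says that `M` contains `z̄f` whenever `f ∈ M` and `z̄f ∈ K_θ^⊥`. Since `conj H₀² ⊥ H²`,
the condition splits over the two summands.

On `M₋` division by `z` never leaves `conj H₀²`, so `conj M₋` is a shift invariant subspace of
`H₀²`, and Beurling's theorem (`eq_bot_or_exists_isInner`) describes it. On the other side `M₊ =
θN`, where `N ⊆ H²` is nearly invariant under the backward shift, and Hitt's theorem
(`IsExtremal.isInner_or_exists_modelSpace`) applies.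

For Hitt's theorem let `g` be the normalised projection of `1` to `N`, and set `R = A(I - g ⊗ g)`
with `A` the backward shift. Every `f ∈ N` satisfies `f = ⟨g,f⟩g + zRf` with orthogonal summands.
Iteration expands `f` as `g` times a power series `Jf`, and `J` is isometric once `Rⁿf → 0`. The
range of `J` is closed and backward shift invariant, so it is `H²` or some `K_β`. In the first case
`g` is inner and serves as `γ`; in the second `G = θg`.

The analytic core is `Rⁿ → 0` strongly (`mem_stableSpace_deflate_backShift`). It is deduced from `Aⁿ
→ 0` by a lower bound for convolution with the positive definite sequence `⟨g, Aⁱg⟩`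
(`sum_norm_sq_le_convolution`). -/

theorem norm_pow_apply_le {A : H →L[ℂ] H} (hA : ∀ x, ‖A x‖ ≤ ‖x‖) (n : ℕ) (x : H) :
    ‖(A ^ n) x‖ ≤ ‖x‖ := by
  induction n with
  | zero => simp
  | succ n ih =>
    rw [pow_succ', mul_apply_eq_comp]
    exact (hA _).trans ih

/-- The vectors on which the powers of a contraction tend to zero. -/
def stableSpace (A : H →L[ℂ] H) : Submodule ℂ H where
  carrier := {x | Tendsto (fun n : ℕ => (A ^ n) x) atTop (𝓝 0)}
  zero_mem' := by simp
  add_mem' := fun {x y} hx hy => by simpa using hx.add hy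
  smul_mem' := fun c x hx => by
    simpa only [Set.mem_ofPred_eq, map_smul, smul_zero] using hx.const_smul c

theorem isClosed_stableSpace {A : H →L[ℂ] H} (hA : ∀ x, ‖A x‖ ≤ ‖x‖) :
    IsClosed (stableSpace A : Set H) := by
  refine isClosed_of_closure_subset fun x hx => ?_
  change Tendsto (fun n : ℕ => (A ^ n) x) atTop (𝓝 0)
  rw [Metric.tendsto_atTop]
  intro ε hε
  obtain ⟨y, hy, hxy⟩ := Metric.mem_closure_iff.1 hx (ε / 2) (by positivity)
  obtain ⟨N, hN⟩ := Metric.tendsto_atTop.1 (show Tendsto (fun n : ℕ => (A ^ n) y) atTop (𝓝 0) from hy)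
    (ε / 2) (by positivity)
  refine ⟨N, fun n hn => ?_⟩
  have h1 := hN n hn
  rw [dist_zero_right] at h1 ⊢
  rw [dist_eq_norm] at hxy
  have h2 := norm_pow_apply_le hA n (x - y)
  calc ‖(A ^ n) x‖ = ‖(A ^ n) (x - y) + (A ^ n) y‖ := by simp
    _ ≤ ‖(A ^ n) (x - y)‖ + ‖(A ^ n) y‖ := norm_add_le _ _
    _ < ε := by linarith

theorem mem_stableSpace_of_apply_mem {A : H →L[ℂ] H} {x : H} (hx : A x ∈ stableSpace A) :
    x ∈ stableSpace A := by
  change Tendsto (fun n : ℕ => (A ^ n) x) atTop (𝓝 0)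
  rw [← tendsto_add_atTop_iff_nat 1]
  simpa [pow_succ] using (show Tendsto (fun n : ℕ => (A ^ n) (A x)) atTop (𝓝 0) from hx)

/-- Convolution with the positive definite sequence `⟨g, Aⁱ g⟩` is bounded below. -/
theorem sum_norm_sq_le_convolution {A : H →L[ℂ] H} (hA : ∀ x, ‖A x‖ ≤ ‖x‖) {g : H}
    (hg : ‖g‖ = 1) (e : ℕ → ℂ) (N : ℕ) :
    ∑ n ∈ Finset.range N, ‖e n‖ ^ 2 ≤
      4 * ∑ n ∈ Finset.range N,
        ‖∑ i ∈ Finset.range (n + 1), e (n - i) * inner ℂ g ((A ^ i) g)‖ ^ 2 := by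
  -- `Z` is the state of the linear system with input `e`; its output `⟨g, Z n⟩` is the convolution.
  -- An energy balance for this system replaces any appeal to positive harmonic functions.
  set Z : ℕ → H := fun n => ∑ i ∈ Finset.range (n + 1), e (n - i) • (A ^ i) g with hZ
  have hm : ∀ n, ∑ i ∈ Finset.range (n + 1), e (n - i) * inner ℂ g ((A ^ i) g)
      = inner ℂ g (Z n) := by
    intro n
    simp only [hZ, inner_sum, inner_smul_right]
  have hrec : ∀ n, Z (n + 1) = e (n + 1) • g + A (Z n) := by
    intro n
    simp only [hZ, map_sum, map_smul]
    rw [Finset.sum_range_succ']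
    rw [add_comm]
    congr 1
    refine Finset.sum_congr rfl fun i _ => ?_
    rw [pow_succ', mul_apply_eq_comp, Nat.add_sub_add_right]
  -- After expanding the square, what remains is `(‖c‖ - 2‖⟨g,z⟩‖)² ≥ 0`; this is the source of the
  -- constant 4.
  have key : ∀ (z : H) (c : ℂ), ‖c‖ ^ 2 + 2 * ‖z‖ ^ 2 ≤
      2 * ‖z - c • g‖ ^ 2 + 4 * ‖(inner ℂ g z : ℂ)‖ ^ 2 := by
    intro z c
    have h1 := norm_sub_sq (𝕜 := ℂ) z (c • g)
    rw [inner_smul_right, norm_smul, hg, mul_one] at h1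
    have h2 : RCLike.re (c * inner ℂ z g) ≤ ‖c‖ * ‖(inner ℂ g z : ℂ)‖ := by
      refine (RCLike.re_le_norm _).trans ?_
      rw [norm_mul, norm_inner_symm]
    nlinarith [sq_nonneg (‖c‖ - 2 * ‖(inner ℂ g z : ℂ)‖)]
  simp_rw [hm]
  -- Keeping the energy `2‖Z N‖²` on the left makes the induction telescope, as `A` does not
  -- increase energy.
  suffices h : ∀ N, ∑ n ∈ Finset.range (N + 1), ‖e n‖ ^ 2 + 2 * ‖Z N‖ ^ 2 ≤
      4 * ∑ n ∈ Finset.range (N + 1), ‖(inner ℂ g (Z n) : ℂ)‖ ^ 2 by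
    cases N with
    | zero => simp
    | succ N => nlinarith [h N, sq_nonneg ‖Z N‖]
  intro N
  induction N with
  | zero =>
    have := key (Z 0) (e 0)
    simp only [hZ] at this ⊢
    simp at this ⊢
    linarith
  | succ N ih =>
    rw [Finset.sum_range_succ, Finset.sum_range_succ _ (N + 1)]
    have h1 := key (Z (N + 1)) (e (N + 1))
    have h2 : ‖Z (N + 1) - e (N + 1) • g‖ ^ 2 ≤ ‖Z N‖ ^ 2 := by
      rw [hrec, add_sub_cancel_left]
      gcongr
      exact hA _
    linarith

/-- The operator `A (I - g ⊗ g)`. -/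
def deflate (A : H →L[ℂ] H) (g : H) : H →L[ℂ] H :=
  A ∘L (ContinuousLinearMap.id ℂ H - (innerSL ℂ g).smulRight g)

@[simp]
theorem deflate_apply (A : H →L[ℂ] H) (g h : H) :
    deflate A g h = A (h - (inner ℂ g h : ℂ) • g) := by
  simp [deflate]

theorem norm_sub_inner_smul_sq {g : H} (hg : ‖g‖ = 1) (h : H) :
    ‖h - (inner ℂ g h : ℂ) • g‖ ^ 2 = ‖h‖ ^ 2 - ‖(inner ℂ g h : ℂ)‖ ^ 2 := by
  have h1 := norm_sub_sq (𝕜 := ℂ) h ((inner ℂ g h : ℂ) • g)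
  rw [inner_smul_right, norm_smul, hg, mul_one, inner_mul_symm_re_eq_norm, norm_mul,
    norm_inner_symm h g] at h1
  rw [h1]; ring

theorem norm_deflate_le {A : H →L[ℂ] H} (hA : ∀ x, ‖A x‖ ≤ ‖x‖) {g : H} (hg : ‖g‖ = 1) (h : H) :
    ‖deflate A g h‖ ≤ ‖h‖ := by
  rw [deflate_apply]
  refine (hA _).trans ?_
  have := norm_sub_inner_smul_sq hg h
  exact le_of_sq_le_sq (by nlinarith [sq_nonneg ‖(inner ℂ g h : ℂ)‖]) (norm_nonneg _)

/-- A discrete Duhamel formula: unroll `A h = R h + ⟨g,h⟩ A g`, where `R = deflate A g`, along the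
orbit of `g`. -/
theorem sum_inner_smul_deflate_pow {A : H →L[ℂ] H} {g : H} (hg : ‖g‖ = 1) (n : ℕ) :
    ∑ i ∈ Finset.range (n + 1), (inner ℂ g ((A ^ i) g) : ℂ) • (deflate A g ^ (n - i)) (A g)
      = (A ^ (n + 1)) g := by
  induction n with
  | zero => simp [hg]
  | succ n ih =>
    rw [Finset.sum_range_succ]
    have h1 : ∑ i ∈ Finset.range (n + 1),
        (inner ℂ g ((A ^ i) g) : ℂ) • (deflate A g ^ (n + 1 - i)) (A g)
        = deflate A g ((A ^ (n + 1)) g) := by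
      rw [← ih, map_sum]
      refine Finset.sum_congr rfl fun i hi => ?_
      have : n + 1 - i = (n - i) + 1 := by
        have := Finset.mem_range.1 hi
        omega
      rw [this, pow_succ', mul_apply_eq_comp, map_smul]
    rw [h1, deflate_apply, map_sub, map_smul, Nat.sub_self, pow_zero,
      one_apply_eq_self, sub_add_cancel, pow_succ' A (n + 1),
      mul_apply_eq_comp]

variable {ι : Type*}

/-- In each coordinate of `b` the Duhamel formula is a scalar convolution, so the lower bound for
convolutions applies; Parseval adds up the coordinates. -/
theorem sum_norm_sq_deflate_pow_le (b : HilbertBasis ι ℂ H) {A : H →L[ℂ] H}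
    (hA : ∀ x, ‖A x‖ ≤ ‖x‖) {g : H} (hg : ‖g‖ = 1) (N : ℕ) :
    ∑ n ∈ Finset.range N, ‖(deflate A g ^ n) (A g)‖ ^ 2 ≤
      4 * ∑ n ∈ Finset.range N, ‖(A ^ (n + 1)) g‖ ^ 2 := by
  have parseval : ∀ x : H, HasSum (fun i => ‖(inner ℂ (b i) x : ℂ)‖ ^ 2) (‖x‖ ^ 2) := by
    intro x
    have h1 := b.hasSum_inner_mul_inner x x
    have h2 := Complex.reCLM.hasSum h1
    convert h2 using 1
    · funext i
      simp only [Complex.reCLM_apply]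
      rw [← inner_conj_symm x (b i), mul_comm, Complex.mul_conj, Complex.ofReal_re,
        Complex.normSq_eq_norm_sq]
    · rw [inner_self_eq_norm_sq_to_K]
      norm_cast
  refine hasSum_le (fun i => ?_)
    (hasSum_sum (s := Finset.range N) fun n _ => parseval ((deflate A g ^ n) (A g)))
    ((hasSum_sum (s := Finset.range N) fun n _ => parseval ((A ^ (n + 1)) g)).mul_left 4)
  refine (sum_norm_sq_le_convolution hA hg
    (fun n => inner ℂ (b i) ((deflate A g ^ n) (A g))) N).trans_eq ?_
  congr 1
  refine Finset.sum_congr rfl fun n _ => ?_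
  rw [← sum_inner_smul_deflate_pow hg n, inner_sum]
  simp_rw [inner_smul_right, mul_comm]

/-- The squared norms along the deflated orbit of `A g` decrease, so each is at most its Cesàro
mean, which is at most four times that of `‖Aⁿ⁺¹g‖²`; the latter means tend to zero. -/
theorem apply_mem_stableSpace_deflate (b : HilbertBasis ι ℂ H) {A : H →L[ℂ] H}
    (hA : ∀ x, ‖A x‖ ≤ ‖x‖) {g : H} (hg : ‖g‖ = 1) (hgA : g ∈ stableSpace A) :
    A g ∈ stableSpace (deflate A g) := by
  have hT := norm_deflate_le hA hg
  have h1 : Tendsto (fun n : ℕ => ‖(A ^ (n + 1)) g‖ ^ 2) atTop (𝓝 0) := by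
    have h2 : Tendsto (fun n : ℕ => (A ^ n) g) atTop (𝓝 0) := hgA
    have := ((h2.comp (tendsto_add_atTop_nat 1)).norm).pow 2
    simpa using this
  have h3 := (h1.cesaro).const_mul 4
  rw [mul_zero] at h3
  have h4 : Tendsto (fun n : ℕ => ‖(deflate A g ^ n) (A g)‖ ^ 2) atTop (𝓝 0) := by
    refine tendsto_of_tendsto_of_tendsto_of_le_of_le' tendsto_const_nhds h3
      (Eventually.of_forall fun n => sq_nonneg _) ?_
    filter_upwards [eventually_gt_atTop 0] with n hn
    have hn' : (0 : ℝ) < n := by exact_mod_cast hn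
    have h5 : n * ‖(deflate A g ^ n) (A g)‖ ^ 2 ≤
        ∑ k ∈ Finset.range n, ‖(deflate A g ^ k) (A g)‖ ^ 2 := by
      rw [← nsmul_eq_mul]
      have h7 := Finset.card_nsmul_le_sum (Finset.range n)
        (fun k => ‖(deflate A g ^ k) (A g)‖ ^ 2) (‖(deflate A g ^ n) (A g)‖ ^ 2) fun k hk => by
          obtain ⟨m, rfl⟩ := Nat.exists_eq_add_of_le' (Finset.mem_range.1 hk).le
          rw [pow_add, mul_apply_eq_comp]
          gcongr
          exact norm_pow_apply_le hT _ _
      rwa [Finset.card_range] at h7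
    have h6 := h5.trans (sum_norm_sq_deflate_pow_le b hA hg n)
    rw [inv_mul_eq_div, ← mul_div_assoc, le_div_iff₀ hn']
    linarith
  change Tendsto _ _ _
  rw [tendsto_zero_iff_norm_tendsto_zero]
  have := h4.sqrt
  simpa using this

end Contraction

/-! ### Multiplication operators and Fourier coefficients. -/

section Multiplication

/-- Multiplication by a bounded function on `L²(𝕋)`. -/
def mulOp (φ : Lp ℂ ∞ haarT) : L2 →L[ℂ] L2 :=
  (ContinuousLinearMap.mul ℂ ℂ).holderL haarT ∞ 2 2 φ

theorem coeFn_mulOp (φ : Lp ℂ ∞ haarT) (f : L2) :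
    ∀ᵐ t ∂haarT, mulOp φ f t = φ t * f t :=
  ContinuousLinearMap.coeFn_holder (ContinuousLinearMap.mul ℂ ℂ) φ f

theorem inner_mulOp_mulOp {φ : Lp ℂ ∞ haarT} (hφ : ∀ᵐ t ∂haarT, ‖φ t‖ = 1) (f g : L2) :
    inner ℂ (mulOp φ f) (mulOp φ g) = inner ℂ f g := by
  rw [L2.inner_def, L2.inner_def]
  refine integral_congr_ae ?_
  filter_upwards [hφ, coeFn_mulOp φ f, coeFn_mulOp φ g] with t h1 h2 h3
  have h4 : φ t * conj (φ t) = 1 := by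
    rw [Complex.mul_conj, Complex.normSq_eq_norm_sq, h1]; simp
  rw [h2, h3, RCLike.inner_apply, RCLike.inner_apply, map_mul]
  linear_combination (g t * conj (f t)) * h4

/-- Multiplication by `z ^ n` on `L²(𝕋)`. -/
def mulZPow (n : ℤ) : L2 →L[ℂ] L2 := mulOp (fourierLp ∞ n)

theorem mulZ_eq_mulZPow : mulZ = mulZPow 1 := rfl

theorem coeFn_mulZPow (n : ℤ) (f : L2) :
    ∀ᵐ t ∂haarT, mulZPow n f t = fourier n t * f t := by
  filter_upwards [coeFn_mulOp (fourierLp ∞ n) f,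
    coeFn_fourierLp (T := (1 : ℝ)) ∞ n] with t h1 h2
  rw [mulZPow, h1, h2]

theorem inner_mulZPow_mulZPow (n : ℤ) (f g : L2) :
    inner ℂ (mulZPow n f) (mulZPow n g) = inner ℂ f g := by
  refine inner_mulOp_mulOp ?_ f g
  filter_upwards [coeFn_fourierLp (T := (1 : ℝ)) ∞ n] with t h
  rw [h, fourier_apply, Circle.norm_coe]

@[simp]
theorem mulZPow_mulZPow (m n : ℤ) (f : L2) : mulZPow m (mulZPow n f) = mulZPow (m + n) f := by
  refine Lp.ext ?_
  filter_upwards [coeFn_mulZPow m (mulZPow n f), coeFn_mulZPow n f,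
    coeFn_mulZPow (m + n) f] with t h1 h2 h3
  rw [h1, h2, h3, fourier_add, mul_assoc]

@[simp]
theorem mulZPow_zero (f : L2) : mulZPow 0 f = f := by
  refine Lp.ext ?_
  filter_upwards [coeFn_mulZPow 0 f] with t h
  rw [h, fourier_zero, one_mul]

theorem norm_mulZPow (n : ℤ) (f : L2) : ‖mulZPow n f‖ = ‖f‖ := by
  rw [@norm_eq_sqrt_re_inner ℂ, @norm_eq_sqrt_re_inner ℂ, inner_mulZPow_mulZPow]

theorem inner_mulZPow_left (n : ℤ) (f g : L2) :
    inner ℂ (mulZPow n f) g = inner ℂ f (mulZPow (-n) g) := by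
  rw [← inner_mulZPow_mulZPow n f, mulZPow_mulZPow, add_neg_cancel, mulZPow_zero]

theorem mulZPow_fourierLp (m n : ℤ) :
    mulZPow m (fourierLp 2 n) = fourierLp 2 (m + n) := by
  refine Lp.ext ?_
  filter_upwards [coeFn_mulZPow m (fourierLp 2 n), coeFn_fourierLp (T := (1 : ℝ)) 2 n,
    coeFn_fourierLp (T := (1 : ℝ)) 2 (m + n)] with t h1 h2 h3
  rw [h1, h2, h3, fourier_add]

theorem fourierCoeff_eq_inner (f : L2) (n : ℤ) :
    fourierCoeff (f : Torus → ℂ) n = inner ℂ (fourierLp 2 n) f := by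
  rw [← fourierBasis_repr, HilbertBasis.repr_apply_apply, coe_fourierBasis]

theorem inner_fourierLp_mulZPow (m n : ℤ) (f : L2) :
    inner ℂ (fourierLp 2 m) (mulZPow n f) = inner ℂ (fourierLp 2 (m - n)) f := by
  rw [← neg_neg n, ← inner_mulZPow_left, mulZPow_fourierLp]
  congr 2
  ring

theorem inner_fourierLp (m n : ℤ) :
    inner ℂ (fourierLp 2 m : L2) (fourierLp 2 n : L2) = if m = n then (1 : ℂ) else 0 :=
  orthonormal_iff_ite.1 (orthonormal_fourier (T := (1 : ℝ))) m n

theorem eq_zero_of_forall_inner_fourierLp {f : L2}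
    (h : ∀ n : ℤ, inner ℂ (fourierLp 2 n) f = 0) : f = 0 := by
  have h1 := (fourierBasis (T := (1 : ℝ))).hasSum_repr f
  simp only [HilbertBasis.repr_apply_apply, coe_fourierBasis, h, zero_smul] at h1
  exact h1.unique hasSum_zero

end Multiplication

/-! ### Uniqueness of Fourier coefficients for integrable functions. -/

section Uniqueness

open Filter Topology

/-- An integrable function on the circle whose Fourier coefficients all vanish is zero. -/
theorem ae_eq_zero_of_fourierCoeff_eq_zero {F : Torus → ℂ} (hF : Integrable F haarT)
    (h : ∀ n : ℤ, ∫ t, fourier n t * F t ∂haarT = 0) : F =ᵐ[haarT] 0 := by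
  have hint : ∀ φ : C(Torus, ℂ), Integrable (fun t => φ t * F t) haarT := fun φ =>
    hF.bdd_mul φ.continuous.aestronglyMeasurable (Eventually.of_forall φ.norm_coe_le_norm)
  let L : C(Torus, ℂ) →ₗ[ℂ] ℂ :=
    { toFun := fun φ => ∫ t, φ t * F t ∂haarT
      map_add' := fun φ ψ => by
        rw [← integral_add (hint φ) (hint ψ)]
        simp [add_mul]
      map_smul' := fun c φ => by
        rw [RingHom.id_apply, smul_eq_mul, ← integral_const_mul]
        simp [mul_assoc] }
  let L' : C(Torus, ℂ) →L[ℂ] ℂ := L.mkContinuous (∫ t, ‖F t‖ ∂haarT) fun φ => by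
    refine (norm_integral_le_integral_norm _).trans ?_
    rw [mul_comm, ← integral_const_mul]
    refine integral_mono (hint φ).norm (hF.norm.const_mul _) fun t => ?_
    change ‖φ t * F t‖ ≤ _
    rw [norm_mul]
    gcongr
    exact φ.norm_coe_le_norm t
  have hL : ∀ φ : C(Torus, ℂ), ∫ t, φ t * F t ∂haarT = 0 := by
    -- Trigonometric polynomials are uniformly dense, so the bounded functional vanishes on all
    -- continuous functions. Thickened indicators then reach closed sets.
    have h1 : (Submodule.span ℂ (Set.range (@fourier (1 : ℝ)))).topologicalClosure ≤ L'.ker := by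
      refine Submodule.topologicalClosure_minimal _ ?_ L'.isClosed_ker
      rw [Submodule.span_le]
      rintro _ ⟨n, rfl⟩
      exact h n
    rw [span_fourier_closure_eq_top] at h1
    exact fun φ => h1 (Submodule.mem_top (x := φ))
  refine ae_eq_zero_of_forall_setIntegral_isClosed_eq_zero hF fun s hs => ?_
  have hδ : ∀ n : ℕ, (0 : ℝ) < 1 / (n + 1) := fun n => by positivity
  let φ : ℕ → C(Torus, ℂ) := fun n =>
    ⟨fun t => ((thickenedIndicator (hδ n) s t : ℝ) : ℂ), by fun_prop⟩
  have hlim : Tendsto (fun n : ℕ => ∫ t, φ n t * F t ∂haarT) atTop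
      (𝓝 (∫ t, s.indicator (fun _ => (1 : ℂ)) t * F t ∂haarT)) := by
    refine tendsto_integral_of_dominated_convergence (fun t => ‖F t‖)
      (fun n => (hint _).aestronglyMeasurable) hF.norm (fun n => Eventually.of_forall fun t => ?_)
      (Eventually.of_forall fun t => ?_)
    · rw [norm_mul]
      refine mul_le_of_le_one_left (norm_nonneg _) ?_
      change ‖((thickenedIndicator (hδ n) s t : ℝ) : ℂ)‖ ≤ 1
      rw [Complex.norm_real, NNReal.norm_eq]
      exact_mod_cast thickenedIndicator_le_one (hδ n) s t
    · refine Tendsto.mul_const _ ?_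
      have h1 := tendsto_pi_nhds.1 (thickenedIndicator_tendsto_indicator_closure hδ
        tendsto_one_div_add_atTop_nhds_zero_nat s) t
      rw [hs.closure_eq] at h1
      have h2 : Tendsto (fun n => φ n t) atTop
          (𝓝 (((s.indicator (fun _ => (1 : NNReal)) t : NNReal) : ℝ) : ℂ)) :=
        (Complex.continuous_ofReal.tendsto _).comp ((NNReal.continuous_coe.tendsto _).comp h1)
      convert h2 using 2
      by_cases ht : t ∈ s <;> simp [ht]
  simp only [hL] at hlim
  have h2 := tendsto_nhds_unique hlim tendsto_const_nhds
  rw [← integral_indicator hs.measurableSet, ← h2]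
  refine integral_congr_ae (Eventually.of_forall fun t => ?_)
  by_cases ht : t ∈ s <;> simp [ht]

theorem integrable_conj_mul (u v : L2) : Integrable (fun t => conj (u t) * v t) haarT := by
  simpa [RCLike.inner_apply, mul_comm] using L2.integrable_inner (𝕜 := ℂ) u v

theorem inner_mulZPow_eq_integral (n : ℤ) (u v : L2) :
    inner ℂ u (mulZPow n v) = ∫ t, fourier n t * (conj (u t) * v t) ∂haarT := by
  rw [L2.inner_def]
  refine integral_congr_ae ?_
  filter_upwards [coeFn_mulZPow n v] with t h
  rw [RCLike.inner_apply, h]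
  ring

/-- If `u` is orthogonal to all `zⁿv`, then `ūv = 0`. -/
theorem conj_mul_ae_eq_zero {u v : L2} (h : ∀ n : ℤ, inner ℂ u (mulZPow n v) = 0) :
    ∀ᵐ t ∂haarT, conj (u t) * v t = 0 :=
  ae_eq_zero_of_fourierCoeff_eq_zero (integrable_conj_mul u v) fun n => by
    rw [← inner_mulZPow_eq_integral, h]

/-- A unit vector that is orthogonal to all its positive shifts is unimodular. -/
theorem norm_ae_eq_one {u : L2} (hu : ‖u‖ = 1)
    (h : ∀ n : ℤ, 0 < n → inner ℂ u (mulZPow n u) = 0) : ∀ᵐ t ∂haarT, ‖u t‖ = 1 := by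
  have h0 : ∀ n : ℤ, n ≠ 0 → inner ℂ u (mulZPow n u) = 0 := by
    intro n hn
    rcases lt_or_gt_of_ne hn with h1 | h1
    · rw [← neg_neg n, ← inner_mulZPow_left, ← inner_conj_symm, h _ (by omega), map_zero]
    · exact h n h1
  -- All Fourier coefficients of `|u|² - 1` vanish; the one at zero does so because `‖u‖ = 1`.
  have h1 : (fun t => conj (u t) * u t - 1) =ᵐ[haarT] 0 := by
    refine ae_eq_zero_of_fourierCoeff_eq_zero
      ((integrable_conj_mul u u).sub (integrable_const _)) fun n => ?_
    have hint : Integrable (fun t => fourier n t * (conj (u t) * u t)) haarT :=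
      (integrable_conj_mul u u).bdd_mul (fourier n).continuous.aestronglyMeasurable
        (Eventually.of_forall (fourier n).norm_coe_le_norm)
    have hint' : Integrable (fun t : Torus => fourier n t) haarT := by
      simpa using (integrable_const (1 : ℂ)).bdd_mul (μ := haarT)
        (fourier n).continuous.aestronglyMeasurable
        (Eventually.of_forall (fourier n).norm_coe_le_norm)
    simp only [mul_sub, mul_one]
    rw [integral_sub hint hint', ← inner_mulZPow_eq_integral]
    have h2 : ∫ t, fourier n t ∂haarT = inner ℂ (fourierLp 2 0 : L2) (fourierLp 2 n : L2) := by
      rw [L2.inner_def]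
      refine integral_congr_ae ?_
      filter_upwards [coeFn_fourierLp (T := (1 : ℝ)) 2 n,
        coeFn_fourierLp (T := (1 : ℝ)) 2 0] with t h3 h4
      rw [h3, h4, RCLike.inner_apply, fourier_zero]
      simp
    rw [h2, inner_fourierLp]
    by_cases hn : n = 0
    · subst hn
      simp [inner_self_eq_norm_sq_to_K, hu]
    · rw [h0 n hn, if_neg (Ne.symm hn), sub_zero]
  filter_upwards [h1] with t ht
  have h2 : ((‖u t‖ ^ 2 : ℝ) : ℂ) = 1 := by
    rw [← Complex.normSq_eq_norm_sq, ← Complex.mul_conj, mul_comm]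
    exact sub_eq_zero.1 ht
  have h3 : ‖u t‖ ^ 2 = 1 := by exact_mod_cast h2
  exact (pow_eq_one_iff_of_nonneg (norm_nonneg _) two_ne_zero).1 h3

end Uniqueness

/-! ### Multiplication by unimodular functions. -/

section Unimodular

open Classical in
/-- Multiplication by `u` on `L²(𝕋)`, for `u` bounded. -/
def mulBy (u : L2) : L2 →L[ℂ] L2 :=
  mulOp (if h : MemLp (u : Torus → ℂ) ∞ haarT then h.toLp u else 0)

theorem toLp_ae_eq {u : L2} (hu : ∀ᵐ t ∂haarT, ‖u t‖ = 1) :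
    ∃ φ : Lp ℂ ∞ haarT, mulBy u = mulOp φ ∧ ∀ᵐ t ∂haarT, φ t = u t := by
  have h : MemLp (u : Torus → ℂ) ∞ haarT :=
    memLp_top_of_bound (Lp.aestronglyMeasurable u) 1 (hu.mono fun t ht => ht.le)
  exact ⟨h.toLp u, by rw [mulBy, dif_pos h], h.coeFn_toLp⟩

theorem coeFn_mulBy {u : L2} (hu : ∀ᵐ t ∂haarT, ‖u t‖ = 1) (f : L2) :
    ∀ᵐ t ∂haarT, mulBy u f t = u t * f t := by
  obtain ⟨φ, h1, h2⟩ := toLp_ae_eq hu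
  rw [h1]
  filter_upwards [h2, coeFn_mulOp φ f] with t h3 h4
  rw [h4, h3]

theorem inner_mulBy_mulBy {u : L2} (hu : ∀ᵐ t ∂haarT, ‖u t‖ = 1) (f g : L2) :
    inner ℂ (mulBy u f) (mulBy u g) = inner ℂ f g := by
  obtain ⟨φ, h1, h2⟩ := toLp_ae_eq hu
  rw [h1]
  refine inner_mulOp_mulOp ?_ f g
  filter_upwards [hu, h2] with t h3 h4
  rw [h4, h3]

theorem norm_mulBy {u : L2} (hu : ∀ᵐ t ∂haarT, ‖u t‖ = 1) (f : L2) : ‖mulBy u f‖ = ‖f‖ := by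
  rw [@norm_eq_sqrt_re_inner ℂ, @norm_eq_sqrt_re_inner ℂ, inner_mulBy_mulBy hu]

theorem norm_star_ae {u : L2} (hu : ∀ᵐ t ∂haarT, ‖u t‖ = 1) :
    ∀ᵐ t ∂haarT, ‖(star u : L2) t‖ = 1 := by
  filter_upwards [hu, Lp.coeFn_star u] with t h1 h2
  rw [h2, Pi.star_apply, norm_star, h1]

theorem mulBy_star_mulBy {u : L2} (hu : ∀ᵐ t ∂haarT, ‖u t‖ = 1) (f : L2) :
    mulBy (star u) (mulBy u f) = f := by
  refine Lp.ext ?_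
  filter_upwards [hu, Lp.coeFn_star u, coeFn_mulBy hu f,
    coeFn_mulBy (norm_star_ae hu) (mulBy u f)] with t h1 h2 h3 h4
  have h5 : u t * conj (u t) = 1 := by
    rw [Complex.mul_conj, Complex.normSq_eq_norm_sq, h1]; simp
  rw [h4, h3, h2, Pi.star_apply, RCLike.star_def]
  linear_combination f t * h5

theorem mulBy_mulBy_star {u : L2} (hu : ∀ᵐ t ∂haarT, ‖u t‖ = 1) (f : L2) :
    mulBy u (mulBy (star u) f) = f := by
  have := mulBy_star_mulBy (norm_star_ae hu) f
  rwa [star_star] at this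

theorem mulBy_mulZPow {u : L2} (hu : ∀ᵐ t ∂haarT, ‖u t‖ = 1) (n : ℤ) (f : L2) :
    mulBy u (mulZPow n f) = mulZPow n (mulBy u f) := by
  refine Lp.ext ?_
  filter_upwards [coeFn_mulBy hu (mulZPow n f), coeFn_mulZPow n f, coeFn_mulBy hu f,
    coeFn_mulZPow n (mulBy u f)] with t h1 h2 h3 h4
  rw [h1, h2, h4, h3]
  ring

theorem mulBy_fourierLp {u : L2} (hu : ∀ᵐ t ∂haarT, ‖u t‖ = 1) (n : ℤ) :
    mulBy u (fourierLp 2 n) = mulZPow n u := by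
  refine Lp.ext ?_
  filter_upwards [coeFn_mulBy hu (fourierLp 2 n), coeFn_mulZPow n u,
    coeFn_fourierLp (T := (1 : ℝ)) 2 n] with t h1 h2 h3
  rw [h1, h2, h3, mul_comm]

theorem mem_mulSpace_iff {u : L2} (hu : ∀ᵐ t ∂haarT, ‖u t‖ = 1) {N : Submodule ℂ L2} {f : L2} :
    f ∈ mulSpace u N ↔ mulBy (star u) f ∈ N := by
  constructor
  · rintro ⟨k, hk, h⟩
    have : f = mulBy u k := by
      refine Lp.ext ?_
      filter_upwards [h, coeFn_mulBy hu k] with t h1 h2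
      rw [h1, h2]
    rwa [this, mulBy_star_mulBy hu]
  · intro h
    refine ⟨_, h, ?_⟩
    have := coeFn_mulBy hu (mulBy (star u) f)
    rwa [mulBy_mulBy_star hu] at this

theorem mulBy_mem_mulSpace {u : L2} (hu : ∀ᵐ t ∂haarT, ‖u t‖ = 1) {N : Submodule ℂ L2} {f : L2}
    (hf : f ∈ N) : mulBy u f ∈ mulSpace u N :=
  ⟨f, hf, coeFn_mulBy hu f⟩

theorem isClosed_mulSpace {u : L2} (hu : ∀ᵐ t ∂haarT, ‖u t‖ = 1) {N : Submodule ℂ L2}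
    (hN : IsClosed (N : Set L2)) : IsClosed (mulSpace u N : Set L2) := by
  have : (mulSpace u N : Set L2) = mulBy (star u) ⁻¹' N := by
    ext f
    exact mem_mulSpace_iff hu
  rw [this]
  exact hN.preimage (mulBy (star u)).continuous

theorem norm_fourierLp_ae (n : ℤ) : ∀ᵐ t ∂haarT, ‖(fourierLp 2 n : L2) t‖ = 1 := by
  filter_upwards [coeFn_fourierLp (T := (1 : ℝ)) 2 n] with t h
  rw [h, fourier_apply, Circle.norm_coe]

end Unimodular

/-! ### Complex conjugation on `L²`. -/

section Conjugation

theorem mem_conjSpace_iff {N : Submodule ℂ L2} {f : L2} : f ∈ conjSpace N ↔ star f ∈ N := by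
  constructor
  · rintro ⟨k, hk, h⟩
    have : star f = k := by
      refine Lp.ext ?_
      filter_upwards [h, Lp.coeFn_star f] with t h1 h2
      rw [h2, Pi.star_apply, h1, RCLike.star_def, Complex.conj_conj]
    rwa [this]
  · intro h
    refine ⟨_, h, ?_⟩
    filter_upwards [Lp.coeFn_star f] with t h1
    rw [h1, Pi.star_apply, RCLike.star_def, Complex.conj_conj]

@[simp]
theorem conjSpace_conjSpace (N : Submodule ℂ L2) : conjSpace (conjSpace N) = N := by
  ext f
  rw [mem_conjSpace_iff, mem_conjSpace_iff, star_star]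

theorem continuous_star_L2 : Continuous (star : L2 → L2) := by
  refine Isometry.continuous (Isometry.of_dist_eq fun f g => ?_)
  rw [dist_eq_norm, dist_eq_norm, Lp.norm_def, Lp.norm_def]
  congr 1
  refine eLpNorm_congr_norm_ae ?_
  filter_upwards [Lp.coeFn_sub (star f) (star g), Lp.coeFn_sub f g, Lp.coeFn_star f,
    Lp.coeFn_star g] with t h1 h2 h3 h4
  rw [h1, h2, Pi.sub_apply, Pi.sub_apply, h3, h4, Pi.star_apply, Pi.star_apply, ← star_sub,
    norm_star]

theorem isClosed_conjSpace {N : Submodule ℂ L2} (hN : IsClosed (N : Set L2)) :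
    IsClosed (conjSpace N : Set L2) := by
  have : (conjSpace N : Set L2) = star ⁻¹' (N : Set L2) := by
    ext f
    exact mem_conjSpace_iff
  rw [this]
  exact hN.preimage continuous_star_L2

theorem star_mulZPow (n : ℤ) (f : L2) : star (mulZPow n f) = mulZPow (-n) (star f) := by
  refine Lp.ext ?_
  filter_upwards [Lp.coeFn_star (mulZPow n f), coeFn_mulZPow n f, coeFn_mulZPow (-n) (star f),
    Lp.coeFn_star f] with t h1 h2 h3 h4
  rw [h1, h3, h4, Pi.star_apply, Pi.star_apply, h2, fourier_neg, star_mul', RCLike.star_def]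

end Conjugation

/-! ### The Hardy space and Beurling's theorem. -/

section Hardy

theorem mem_hardy_iff {f : L2} :
    f ∈ hardy ↔ ∀ n : ℤ, n < 0 → inner ℂ (fourierLp 2 n : L2) f = 0 := by
  simp only [← fourierCoeff_eq_inner]
  rfl

theorem isClosed_hardy : IsClosed (hardy : Set L2) := by
  have : (hardy : Set L2) =
      ⋂ (n : ℤ) (_ : n < 0), {f : L2 | inner ℂ (fourierLp 2 n : L2) f = 0} := by
    ext f
    simp [mem_hardy_iff]
  rw [this]
  exact isClosed_biInter fun n _ => isClosed_eq (by fun_prop) continuous_const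

instance : CompleteSpace hardy := isClosed_hardy.completeSpace_coe

theorem fourierLp_mem_hardy {n : ℤ} (hn : 0 ≤ n) : (fourierLp 2 n : L2) ∈ hardy := by
  rw [mem_hardy_iff]
  intro m hm
  rw [inner_fourierLp, if_neg (by omega)]

theorem mulZPow_mem_hardy {n : ℤ} (hn : 0 ≤ n) {f : L2} (hf : f ∈ hardy) :
    mulZPow n f ∈ hardy := by
  rw [mem_hardy_iff] at hf ⊢
  intro m hm
  rw [inner_fourierLp_mulZPow, hf _ (by omega)]

theorem mulZPow_neg_one_mem_hardy {f : L2} (hf : f ∈ hardy)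
    (h0 : inner ℂ (fourierLp 2 0 : L2) f = 0) : mulZPow (-1) f ∈ hardy := by
  rw [mem_hardy_iff] at hf ⊢
  intro m hm
  rw [inner_fourierLp_mulZPow]
  rcases eq_or_ne m (-1) with rfl | h
  · simpa using h0
  · exact hf _ (by omega)

theorem mem_hardyZero_iff {f : L2} : f ∈ hardyZero ↔ mulZPow (-1) f ∈ hardy := by
  have h : mulBy (star (fourierLp 2 1 : L2)) f = mulZPow (-1) f := by
    refine Lp.ext ?_
    filter_upwards [coeFn_mulBy (norm_star_ae (norm_fourierLp_ae 1)) f, coeFn_mulZPow (-1) f,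
      Lp.coeFn_star (fourierLp 2 1 : L2), coeFn_fourierLp (T := (1 : ℝ)) 2 1] with t h1 h2 h3 h4
    rw [h1, h2, h3, Pi.star_apply, h4, fourier_neg]
    rfl
  rw [hardyZero, mem_mulSpace_iff (norm_fourierLp_ae 1), h]

theorem hardyZero_le_hardy : hardyZero ≤ hardy := by
  intro f hf
  have := mulZPow_mem_hardy zero_le_one (mem_hardyZero_iff.1 hf)
  simpa using this

theorem hardy_le {N : Submodule ℂ L2} (hN : IsClosed (N : Set L2))
    (h : ∀ n : ℤ, 0 ≤ n → (fourierLp 2 n : L2) ∈ N) : hardy ≤ N := by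
  intro f hf
  have h1 := hasSum_fourier_series_L2 f
  refine hN.mem_of_tendsto h1 (Filter.Eventually.of_forall fun s => ?_)
  refine N.sum_mem fun n _ => ?_
  rcases lt_or_ge n 0 with hn | hn
  · rw [show fourierCoeff (f : Torus → ℂ) n = 0 from hf n hn, zero_smul]
    exact N.zero_mem
  · exact N.smul_mem _ (h n hn)

/-- The `n`-th coefficient of `f` is the coefficient at `-1` of `z^{-(n+1)} f`, which still lies in
`H²`. -/
theorem eq_bot_of_backward_invariant {N : Submodule ℂ L2} (hN : N ≤ hardy)
    (h : ∀ f ∈ N, mulZPow (-1) f ∈ N) : N = ⊥ := by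
  rw [eq_bot_iff]
  intro f hf
  rw [Submodule.mem_bot]
  have h1 : ∀ n : ℕ, mulZPow (-(n : ℤ)) f ∈ N := by
    intro n
    induction n with
    | zero => simpa using hf
    | succ n ih =>
      have := h _ ih
      rw [mulZPow_mulZPow] at this
      convert this using 2
      push_cast
      ring_nf
  refine eq_zero_of_forall_inner_fourierLp fun n => ?_
  rcases lt_or_ge n 0 with hn | hn
  · exact mem_hardy_iff.1 (hN hf) n hn
  · obtain ⟨k, rfl⟩ := Int.eq_ofNat_of_zero_le hn
    have := mem_hardy_iff.1 (hN (h1 (k + 1))) (-1) (by norm_num)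
    rw [inner_fourierLp_mulZPow] at this
    convert this using 3
    push_cast
    ring

theorem mulZPow_natCast_mem {N : Submodule ℂ L2} (hz : ∀ f ∈ N, mulZPow 1 f ∈ N) {f : L2}
    (hf : f ∈ N) (n : ℕ) : mulZPow n f ∈ N := by
  induction n with
  | zero => simpa using hf
  | succ n ih =>
    have := hz _ ih
    rwa [mulZPow_mulZPow, add_comm, ← Nat.cast_succ] at this

theorem isClosed_comap {N : Submodule ℂ L2} (hcl : IsClosed (N : Set L2)) (A : L2 →L[ℂ] L2) :
    IsClosed ((N.comap A.toLinearMap : Submodule ℂ L2) : Set L2) :=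
  hcl.preimage A.continuous

/-- A nonzero closed shift invariant subspace contains a unit vector that is orthogonal to its
image under the shift. -/
theorem exists_wandering_vector {N : Submodule ℂ L2} (hcl : IsClosed (N : Set L2))
    (hN : N ≤ hardy) (hz : ∀ f ∈ N, mulZPow 1 f ∈ N) (hne : N ≠ ⊥) :
    ∃ u ∈ N, ‖u‖ = 1 ∧ ∀ f ∈ N, ∀ n : ℤ, 0 < n → inner ℂ u (mulZPow n f) = 0 := by
  -- `S` is `zN`. If `N ⊖ zN` were trivial, `N = zN` would be invariant under `z̄`, hence zero.
  obtain ⟨S, hS⟩ : ∃ S : Submodule ℂ L2, S = N.comap (mulZPow (-1)).toLinearMap := ⟨_, rfl⟩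
  have hmem : ∀ f, f ∈ S ↔ mulZPow (-1) f ∈ N := fun f => by rw [hS]; exact Iff.rfl
  have hSN : S ≤ N := fun f hf => by simpa using hz _ ((hmem f).1 hf)
  have hScl : IsClosed (S : Set L2) := hS ▸ isClosed_comap hcl _
  have : CompleteSpace S := hScl.completeSpace_coe
  have hbot : Sᗮ ⊓ N ≠ ⊥ := fun hbot => hne <| by
    refine eq_bot_of_backward_invariant hN fun f hf => ?_
    have h1 := Submodule.sup_orthogonal_inf_of_hasOrthogonalProjection hSN
    rw [hbot, sup_bot_eq] at h1
    rw [← h1] at hf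
    exact (hmem f).1 hf
  obtain ⟨u, ⟨huS, huN⟩, hu⟩ := Submodule.exists_mem_ne_zero_of_ne_bot hbot
  refine ⟨((‖u‖⁻¹ : ℝ) : ℂ) • u, N.smul_mem _ huN, ?_, fun f hf n hn => ?_⟩
  · rw [norm_smul, Complex.norm_real, norm_inv, norm_norm,
      inv_mul_cancel₀ (norm_ne_zero_iff.2 hu)]
  · rw [inner_smul_left, ← inner_conj_symm, (Submodule.mem_orthogonal _ _).1 huS, map_zero,
      mul_zero]
    rw [hmem, mulZPow_mulZPow]
    have := mulZPow_natCast_mem hz hf (-1 + n).toNat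
    rwa [Int.toNat_of_nonneg (by omega)] at this

/-- `N` contains every `zⁿu` with `n ≥ 0`; these are the images of the spanning monomials of `H²`
under a continuous map. -/
theorem mulSpace_hardy_le {N : Submodule ℂ L2} (hcl : IsClosed (N : Set L2))
    (hz : ∀ f ∈ N, mulZPow 1 f ∈ N) {u : L2} (huN : u ∈ N) (hmod : ∀ᵐ t ∂haarT, ‖u t‖ = 1) :
    mulSpace u hardy ≤ N := by
  have h1 : hardy ≤ N.comap (mulBy u).toLinearMap := by
    refine hardy_le (isClosed_comap hcl _) fun n hn => ?_
    obtain ⟨k, rfl⟩ := Int.eq_ofNat_of_zero_le hn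
    rw [Submodule.mem_comap, ContinuousLinearMap.coe_coe, mulBy_fourierLp hmod]
    exact mulZPow_natCast_mem hz huN k
  intro f hf
  have h2 := h1 ((mem_mulSpace_iff hmod).1 hf)
  rwa [Submodule.mem_comap, ContinuousLinearMap.coe_coe, mulBy_mulBy_star hmod] at h2

/-- Beurling's theorem. -/
theorem eq_bot_or_exists_isInner {N : Submodule ℂ L2} (hcl : IsClosed (N : Set L2))
    (hN : N ≤ hardy) (hz : ∀ f ∈ N, mulZPow 1 f ∈ N) :
    N = ⊥ ∨ ∃ u : L2, IsInner u ∧ u ∈ N ∧ N = mulSpace u hardy := by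
  refine or_iff_not_imp_left.2 fun hne => ?_
  obtain ⟨u, huN, hu1, horth⟩ := exists_wandering_vector hcl hN hz hne
  have hmod := norm_ae_eq_one hu1 fun n hn => horth u huN n hn
  refine ⟨u, ⟨hN huN, hmod⟩, huN, ?_⟩
  have : CompleteSpace (mulSpace u hardy) :=
    (isClosed_mulSpace hmod isClosed_hardy).completeSpace_coe
  have h1 := Submodule.sup_orthogonal_inf_of_hasOrthogonalProjection
    (mulSpace_hardy_le hcl hz huN hmod)
  suffices h2 : (mulSpace u hardy)ᗮ ⊓ N = ⊥ by
    rw [h2, sup_bot_eq] at h1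
    exact h1.symm
  rw [eq_bot_iff]
  rintro v ⟨hv, hvN⟩
  rw [Submodule.mem_bot]
  -- Coefficients with `n > 0` vanish because `u` is wandering, those with `n ≤ 0` because `v ⊥
  -- uH²`.
  have h3 : ∀ᵐ t ∂haarT, conj (u t) * v t = 0 := by
    refine conj_mul_ae_eq_zero fun n => ?_
    rcases lt_or_ge 0 n with hn | hn
    · exact horth v hvN n hn
    · have h4 := (Submodule.mem_orthogonal _ _).1 hv _
        (mulBy_mem_mulSpace hmod (fourierLp_mem_hardy (n := -n) (by omega)))
      rwa [mulBy_fourierLp hmod, inner_mulZPow_left, neg_neg] at h4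
  refine Lp.ext ?_
  filter_upwards [h3, hmod, Lp.coeFn_zero ℂ 2 haarT] with t h4 h5 h6
  rw [h6, Pi.zero_apply]
  refine (mul_eq_zero.1 h4).resolve_left fun h7 => ?_
  rw [map_eq_zero] at h7
  rw [h7, norm_zero] at h5
  exact zero_ne_one h5

end Hardy

/-! ### Strong stability of the backward shift and of its deflation. -/

section BackwardShift

open Filter Topology

/-- The backward shift `f ↦ P(z̄f)`, where `P` is the orthogonal projection onto `H²`. -/
def backShift : L2 →L[ℂ] L2 := hardy.starProjection ∘L mulZPow (-1)

theorem norm_backShift_le (f : L2) : ‖backShift f‖ ≤ ‖f‖ :=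
  (Submodule.norm_starProjection_apply_le hardy _).trans_eq (norm_mulZPow _ _)

theorem backShift_mem_hardy (f : L2) : backShift f ∈ hardy :=
  Submodule.starProjection_apply_mem hardy _

theorem backShift_eq_mulZPow {f : L2} (hf : f ∈ hardy)
    (h0 : inner ℂ (fourierLp 2 0 : L2) f = 0) : backShift f = mulZPow (-1) f :=
  Submodule.starProjection_eq_self_iff.2 (mulZPow_neg_one_mem_hardy hf h0)

theorem inner_backShift_left {v : L2} (hv : v ∈ hardy) (f : L2) :
    inner ℂ (backShift f) v = inner ℂ f (mulZPow 1 v) := by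
  rw [backShift, ContinuousLinearMap.comp_apply, Submodule.inner_starProjection_left_eq_right,
    Submodule.starProjection_eq_self_iff.2 hv, inner_mulZPow_left, neg_neg]

theorem inner_backShift_right {v : L2} (hv : v ∈ hardy) (f : L2) :
    inner ℂ v (backShift f) = inner ℂ (mulZPow 1 v) f := by
  rw [← inner_conj_symm, inner_backShift_left hv, inner_conj_symm]

theorem backShift_fourierLp_of_nonpos {n : ℤ} (hn : n ≤ 0) :
    backShift (fourierLp 2 n) = 0 := by
  rw [backShift, ContinuousLinearMap.comp_apply, mulZPow_fourierLp,
    Submodule.starProjection_apply_eq_zero_iff, Submodule.mem_orthogonal]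
  intro f hf
  rw [← inner_conj_symm, mem_hardy_iff.1 hf _ (by omega), map_zero]

theorem backShift_fourierLp_of_pos {n : ℤ} (hn : 0 < n) :
    backShift (fourierLp 2 n) = fourierLp 2 (n - 1) := by
  rw [backShift_eq_mulZPow (fourierLp_mem_hardy hn.le)
    (by rw [inner_fourierLp, if_neg hn.ne]), mulZPow_fourierLp]
  congr 1
  ring

theorem mem_of_forall_fourierLp_mem {N : Submodule ℂ L2} (hN : IsClosed (N : Set L2))
    (h : ∀ n : ℤ, (fourierLp 2 n : L2) ∈ N) (f : L2) : f ∈ N :=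
  hN.mem_of_tendsto (hasSum_fourier_series_L2 f) (Eventually.of_forall fun _ =>
    N.sum_mem fun n _ => N.smul_mem _ (h n))

/-- Each monomial is annihilated after finitely many steps, and the stable space is closed. -/
theorem mem_stableSpace_backShift (f : L2) : f ∈ stableSpace backShift := by
  have hneg : ∀ n : ℤ, n ≤ 0 → (fourierLp 2 n : L2) ∈ stableSpace backShift := fun n hn =>
    mem_stableSpace_of_apply_mem (by
      rw [backShift_fourierLp_of_nonpos hn]
      exact Submodule.zero_mem _)
  refine mem_of_forall_fourierLp_mem (isClosed_stableSpace norm_backShift_le) (fun n => ?_) f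
  rcases le_total n 0 with hn | hn
  · exact hneg n hn
  · induction n, hn using Int.leInduction with
    | base => exact hneg 0 le_rfl
    | succ n hn ih =>
      refine mem_stableSpace_of_apply_mem ?_
      rwa [backShift_fourierLp_of_pos (by omega), add_sub_cancel_right]

/-- The deflation sends `f` to `A f - ⟨g,f⟩ A g`. As `A g` is stable, stability of `A f` gives that
of `f`, and induction on the degree reaches all monomials. -/
theorem mem_stableSpace_deflate_backShift {g : L2} (hg : ‖g‖ = 1) (f : L2) :
    f ∈ stableSpace (deflate backShift g) := by
  have hAg : backShift g ∈ stableSpace (deflate backShift g) :=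
    apply_mem_stableSpace_deflate (fourierBasis (T := (1 : ℝ))) norm_backShift_le hg
      (mem_stableSpace_backShift g)
  have hmem : ∀ f : L2, backShift f ∈ stableSpace (deflate backShift g) →
      f ∈ stableSpace (deflate backShift g) := fun f hf =>
    mem_stableSpace_of_apply_mem (by
      rw [deflate_apply, map_sub, map_smul]
      exact Submodule.sub_mem _ hf (Submodule.smul_mem _ _ hAg))
  have hneg : ∀ n : ℤ, n ≤ 0 → (fourierLp 2 n : L2) ∈ stableSpace (deflate backShift g) :=
    fun n hn => hmem _ (by
      rw [backShift_fourierLp_of_nonpos hn]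
      exact Submodule.zero_mem _)
  refine mem_of_forall_fourierLp_mem
    (isClosed_stableSpace (norm_deflate_le norm_backShift_le hg)) (fun n => ?_) f
  rcases le_total n 0 with hn | hn
  · exact hneg n hn
  · induction n, hn using Int.leInduction with
    | base => exact hneg 0 le_rfl
    | succ n hn ih =>
      refine hmem _ ?_
      rwa [backShift_fourierLp_of_pos (by omega), add_sub_cancel_right]

/-- Products pass to `L²` limits almost everywhere. -/
theorem ae_eq_mul_of_tendsto {g f q : L2} {F Q : ℕ → L2} (hF : Tendsto F atTop (𝓝 f))
    (hQ : Tendsto Q atTop (𝓝 q)) (h : ∀ n, ∀ᵐ t ∂haarT, F n t = g t * Q n t) :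
    ∀ᵐ t ∂haarT, f t = g t * q t := by
  -- Multiplication by `g` need not be bounded on `L²`, so limits are compared pointwise along
  -- nested subsequences.
  obtain ⟨ns, hns, h1⟩ := (tendstoInMeasure_of_tendsto_Lp hF).exists_seq_tendsto_ae
  obtain ⟨ms, hms, h2⟩ :=
    (tendstoInMeasure_of_tendsto_Lp (hQ.comp hns.tendsto_atTop)).exists_seq_tendsto_ae
  filter_upwards [h1, h2, ae_all_iff.2 h] with t h3 h4 h5
  refine tendsto_nhds_unique (h3.comp hms.tendsto_atTop) ?_
  simp only [Function.comp_def, h5]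
  exact h4.const_mul (g t)

end BackwardShift

/-! ### Hitt's expansion of a nearly invariant subspace along its extremal vector. -/

section NearlyInvariant

open Filter Topology

/-- `N` is a closed nearly backward shift invariant subspace of `H²`, and `g` is a unit vector of
`N` such that `N ∩ zH² = N ∩ {g}^⊥`. -/
structure IsExtremal (N : Submodule ℂ L2) (g : L2) : Prop where
  isClosed : IsClosed (N : Set L2)
  le_hardy : N ≤ hardy
  near : ∀ f ∈ N, inner ℂ (fourierLp 2 0 : L2) f = 0 → mulZPow (-1) f ∈ N
  mem : g ∈ N
  norm_eq : ‖g‖ = 1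
  inner_eq : ∀ f ∈ N, inner ℂ g f = 0 → inner ℂ (fourierLp 2 0 : L2) f = 0

namespace IsExtremal

variable {N : Submodule ℂ L2} {g : L2} (h : IsExtremal N g)

include h

theorem sub_mem {f : L2} (hf : f ∈ N) : f - (inner ℂ g f : ℂ) • g ∈ N :=
  N.sub_mem hf (N.smul_mem _ h.mem)

theorem inner_sub {f : L2} (hf : f ∈ N) :
    inner ℂ (fourierLp 2 0 : L2) (f - (inner ℂ g f : ℂ) • g) = 0 := by
  refine h.inner_eq _ (h.sub_mem hf) ?_
  rw [inner_sub_right, inner_smul_right, inner_self_eq_norm_sq_to_K, h.norm_eq]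
  simp

theorem deflate_eq {f : L2} (hf : f ∈ N) :
    deflate backShift g f = mulZPow (-1) (f - (inner ℂ g f : ℂ) • g) := by
  rw [deflate_apply, backShift_eq_mulZPow (h.le_hardy (h.sub_mem hf)) (h.inner_sub hf)]

theorem deflate_mem {f : L2} (hf : f ∈ N) : deflate backShift g f ∈ N := by
  rw [h.deflate_eq hf]
  exact h.near _ (h.sub_mem hf) (h.inner_sub hf)

theorem deflate_pow_mem {f : L2} (hf : f ∈ N) (n : ℕ) : (deflate backShift g ^ n) f ∈ N := by
  induction n with
  | zero => exact hf
  | succ n ih =>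
    rw [pow_succ', mul_apply_eq_comp]
    exact h.deflate_mem ih

/-- One step of Hitt's algorithm: subtracting the component along `g` kills the value at zero, so
division by `z` stays in `N`. -/
theorem eq_add {f : L2} (hf : f ∈ N) :
    f = (inner ℂ g f : ℂ) • g + mulZPow 1 (deflate backShift g f) := by
  rw [h.deflate_eq hf, mulZPow_mulZPow, add_neg_cancel, mulZPow_zero, add_sub_cancel]

theorem norm_sq_eq {f : L2} (hf : f ∈ N) :
    ‖f‖ ^ 2 = ‖(inner ℂ g f : ℂ)‖ ^ 2 + ‖deflate backShift g f‖ ^ 2 := by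
  rw [h.deflate_eq hf, norm_mulZPow, norm_sub_inner_smul_sq h.norm_eq]
  ring

theorem eq_sum_add {f : L2} (hf : f ∈ N) (n : ℕ) :
    f = ∑ i ∈ Finset.range n,
        (inner ℂ g ((deflate backShift g ^ i) f) : ℂ) • mulZPow i g
      + mulZPow n ((deflate backShift g ^ n) f) := by
  induction n with
  | zero => simp
  | succ n ih =>
    have h1 := congrArg (mulZPow n) (h.eq_add (h.deflate_pow_mem hf n))
    rw [map_add, map_smul, mulZPow_mulZPow, ← mul_apply_eq_comp (deflate backShift g), ← pow_succ',
      ← Nat.cast_succ] at h1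
    rw [Finset.sum_range_succ, add_assoc, ← h1]
    exact ih

theorem norm_sq_eq_sum_add {f : L2} (hf : f ∈ N) (n : ℕ) :
    ‖f‖ ^ 2 = ∑ i ∈ Finset.range n, ‖(inner ℂ g ((deflate backShift g ^ i) f) : ℂ)‖ ^ 2
      + ‖(deflate backShift g ^ n) f‖ ^ 2 := by
  induction n with
  | zero => simp
  | succ n ih =>
    rw [Finset.sum_range_succ, add_assoc, pow_succ' _ n, mul_apply_eq_comp,
      ← h.norm_sq_eq (h.deflate_pow_mem hf n)]
    exact ih

theorem tendsto_deflate_pow (f : L2) :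
    Tendsto (fun n : ℕ => (deflate backShift g ^ n) f) atTop (𝓝 0) :=
  mem_stableSpace_deflate_backShift h.norm_eq f

/-- Stability of the deflation removes the remainder from the finite energy identity; without it `J`
would only be contractive. -/
theorem hasSum_norm_sq {f : L2} (hf : f ∈ N) :
    HasSum (fun i : ℕ => ‖(inner ℂ g ((deflate backShift g ^ i) f) : ℂ)‖ ^ 2) (‖f‖ ^ 2) := by
  rw [hasSum_iff_tendsto_nat_of_nonneg fun i => sq_nonneg _]
  have h1 : Tendsto (fun n : ℕ => ‖f‖ ^ 2 - ‖(deflate backShift g ^ n) f‖ ^ 2) atTop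
      (𝓝 (‖f‖ ^ 2 - ‖(0 : L2)‖ ^ 2)) :=
    tendsto_const_nhds.sub ((h.tendsto_deflate_pow f).norm.pow 2)
  rw [norm_zero, zero_pow two_ne_zero, sub_zero] at h1
  refine h1.congr fun n => ?_
  rw [h.norm_sq_eq_sum_add hf n, add_sub_cancel_right]

theorem tendsto_sum {f : L2} (hf : f ∈ N) :
    Tendsto (fun n : ℕ => ∑ i ∈ Finset.range n,
      (inner ℂ g ((deflate backShift g ^ i) f) : ℂ) • mulZPow i g) atTop (𝓝 f) := by
  have h1 : Tendsto (fun n : ℕ => f - mulZPow n ((deflate backShift g ^ n) f)) atTop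
      (𝓝 (f - 0)) := by
    refine tendsto_const_nhds.sub ?_
    rw [tendsto_zero_iff_norm_tendsto_zero]
    simpa [norm_mulZPow] using (h.tendsto_deflate_pow f).norm
  rw [sub_zero] at h1
  refine h1.congr fun n => ?_
  conv_lhs => rw [h.eq_sum_add hf n]
  rw [add_sub_assoc, ← h.eq_sum_add hf n, sub_self, add_zero]

/-- The quotients `f / g`, given by their power series, depend isometrically on `f ∈ N`. -/
theorem exists_quotient_isometry :
    ∃ J : N →ₗᵢ[ℂ] L2, ∀ f : N, HasSum (fun i : ℕ =>
      (inner ℂ g ((deflate backShift g ^ i) f) : ℂ) • (fourierLp 2 (i : ℤ) : L2)) (J f) := by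
  have hsummable : ∀ f : N, Memℓp (fun i : ℕ =>
      (inner ℂ g ((deflate backShift g ^ i) (f : L2)) : ℂ)) 2 := fun f => by
    refine memℓp_gen ?_
    simpa using (h.hasSum_norm_sq f.2).summable
  let C : N →ₗ[ℂ] lp (fun _ : ℕ => ℂ) 2 :=
    { toFun := fun f => ⟨_, hsummable f⟩
      map_add' := fun f f' => by
        ext i
        simp only [Submodule.coe_add, map_add, inner_add_right]
        rfl
      map_smul' := fun c f => by
        ext i
        simp only [Submodule.coe_smul, map_smul, inner_smul_right]
        rfl }
  have hCi : ∀ f (i : ℕ), (C f : ℕ → ℂ) i = inner ℂ g ((deflate backShift g ^ i) (f : L2)) :=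
    fun f i => rfl
  have hC : ∀ f, ‖C f‖ = ‖f‖ := fun f => by
    have h1 := lp.hasSum_norm (p := 2) (by simp) (C f)
    have h2 : HasSum (fun i : ℕ => ‖C f i‖ ^ (2 : ℝ≥0∞).toReal) (‖(f : L2)‖ ^ 2) := by
      simpa [hCi] using h.hasSum_norm_sq f.2
    have h3 := h1.unique h2
    simp only [ENNReal.toReal_ofNat, Real.rpow_ofNat] at h3
    exact (pow_left_inj₀ (norm_nonneg _) (norm_nonneg _) two_ne_zero).1 h3
  have hortho : Orthonormal ℂ (fun i : ℕ => (fourierLp 2 (i : ℤ) : L2)) :=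
    (orthonormal_fourier (T := (1 : ℝ))).comp _ Nat.cast_injective
  refine ⟨(hortho.orthogonalFamily.linearIsometry).comp ⟨C, hC⟩, fun f => ?_⟩
  have h4 := hortho.orthogonalFamily.hasSum_linearIsometry (C f)
  simpa [hCi] using h4

end IsExtremal

end NearlyInvariant

/-! ### Backward shift invariant subspaces and Hitt's theorem. -/

section Hitt

open Filter Topology

/-- A closed backward shift invariant subspace of `H²` is `H²` or a model space. -/
theorem eq_hardy_or_exists_modelSpace {K : Submodule ℂ L2} (hcl : IsClosed (K : Set L2))
    (hK : K ≤ hardy) (hinv : ∀ q ∈ K, backShift q ∈ K) :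
    K = hardy ∨ ∃ β : L2, IsInner β ∧ K = modelSpace β := by
  have : CompleteSpace K := hcl.completeSpace_coe
  have hsup := Submodule.sup_orthogonal_inf_of_hasOrthogonalProjection hK
  have hLcl : IsClosed ((Kᗮ ⊓ hardy : Submodule ℂ L2) : Set L2) :=
    K.isClosed_orthogonal.inter isClosed_hardy
  -- By adjointness `H² ⊖ K` is shift invariant, so Beurling's theorem makes it zero or `βH²`.
  have hLz : ∀ f ∈ Kᗮ ⊓ hardy, mulZPow 1 f ∈ Kᗮ ⊓ hardy := by
    rintro f ⟨hfK, hf⟩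
    refine ⟨(Submodule.mem_orthogonal _ _).2 fun q hq => ?_, mulZPow_mem_hardy zero_le_one hf⟩
    rw [← inner_backShift_left hf]
    exact (Submodule.mem_orthogonal _ _).1 hfK _ (hinv q hq)
  rcases eq_bot_or_exists_isInner hLcl inf_le_right hLz with hbot | ⟨β, hβ, -, hL⟩
  · left
    rwa [hbot, sup_bot_eq] at hsup
  · refine Or.inr ⟨β, hβ, ?_⟩
    rw [modelSpace, ← hL]
    refine le_antisymm (le_inf hK fun k hk => ?_) ?_
    · rw [Submodule.mem_orthogonal]
      rintro l ⟨hl, -⟩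
      rw [← inner_conj_symm, (Submodule.mem_orthogonal _ _).1 hl k hk, map_zero]
    · rintro f ⟨hf, hfL⟩
      rw [SetLike.mem_coe, ← hsup] at hf
      obtain ⟨k, hk, l, hl, rfl⟩ := Submodule.mem_sup.1 hf
      have h1 := (Submodule.mem_orthogonal _ _).1 hfL l hl
      have h2 : inner ℂ l k = 0 := by
        rw [← inner_conj_symm, (Submodule.mem_orthogonal _ _).1 hl.1 k hk, map_zero]
      rw [inner_add_right, h2, zero_add, inner_self_eq_zero] at h1
      rwa [h1, add_zero]

namespace IsExtremal

variable {N : Submodule ℂ L2} {g : L2}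

/-- Hitt's theorem, for a subspace with a given extremal vector. -/
theorem isInner_or_exists_modelSpace (h : IsExtremal N g) :
    (IsInner g ∧ N = mulSpace g hardy) ∨
      ∃ β : L2, IsInner β ∧
        (∀ k ∈ modelSpace β, ∃ f ∈ N, ∀ᵐ t ∂haarT, f t = g t * k t) ∧
        ∀ f ∈ N, ∃ k ∈ modelSpace β, ∀ᵐ t ∂haarT, f t = g t * k t := by
  obtain ⟨J, hJ⟩ := h.exists_quotient_isometry
  have hJhardy : ∀ f, J f ∈ hardy := fun f =>
    isClosed_hardy.mem_of_tendsto (hJ f) (Eventually.of_forall fun s =>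
      hardy.sum_mem fun i _ => hardy.smul_mem _ (fourierLp_mem_hardy (Int.natCast_nonneg i)))
  have hcoeff : ∀ f (k : ℕ), inner ℂ (fourierLp 2 (k : ℤ) : L2) (J f)
      = inner ℂ g ((deflate backShift g ^ k) (f : L2)) := by
    intro f k
    have h1 := (innerSL ℂ (fourierLp 2 (k : ℤ) : L2)).hasSum (hJ f)
    simp only [innerSL_apply_apply] at h1
    refine h1.unique ?_
    convert hasSum_single k fun i hi => ?_ using 1
    · rw [inner_smul_right, inner_fourierLp, if_pos rfl, mul_one]
    · rw [inner_smul_right, inner_fourierLp, if_neg (by exact_mod_cast hi.symm), mul_zero]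
  have hext : ∀ u v : L2, u ∈ hardy → v ∈ hardy →
      (∀ k : ℕ, inner ℂ (fourierLp 2 (k : ℤ) : L2) u = inner ℂ (fourierLp 2 (k : ℤ) : L2) v) →
      u = v := by
    intro u v hu hv huv
    rw [← sub_eq_zero]
    refine eq_zero_of_forall_inner_fourierLp fun n => ?_
    rcases lt_or_ge n 0 with hn | hn
    · exact mem_hardy_iff.1 (hardy.sub_mem hu hv) n hn
    · obtain ⟨k, rfl⟩ := Int.eq_ofNat_of_zero_le hn
      rw [inner_sub_right, huv, sub_self]
  have hprod : ∀ f : N, ∀ᵐ t ∂haarT, (f : L2) t = g t * J f t := by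
    intro f
    refine ae_eq_mul_of_tendsto (h.tendsto_sum f.2) (hJ f).tendsto_sum_nat fun n => ?_
    induction n with
    | zero =>
      filter_upwards with t
      simp
    | succ n ih =>
      simp only [Finset.sum_range_succ]
      set c : ℂ := inner ℂ g ((deflate backShift g ^ n) (f : L2))
      set F : L2 := ∑ i ∈ Finset.range n,
        (inner ℂ g ((deflate backShift g ^ i) (f : L2)) : ℂ) • mulZPow i g
      set Q : L2 := ∑ i ∈ Finset.range n,
        (inner ℂ g ((deflate backShift g ^ i) (f : L2)) : ℂ) • (fourierLp 2 (i : ℤ) : L2)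
      filter_upwards [ih, Lp.coeFn_add F (c • mulZPow n g), Lp.coeFn_smul c (mulZPow n g),
        Lp.coeFn_add Q (c • (fourierLp 2 (n : ℤ) : L2)),
        Lp.coeFn_smul c (fourierLp 2 (n : ℤ) : L2), coeFn_mulZPow n g,
        coeFn_fourierLp (T := (1 : ℝ)) 2 n] with t h0 h1 h2 h3 h4 h5 h6
      rw [h1, h3, Pi.add_apply, Pi.add_apply, h2, h4, Pi.smul_apply, Pi.smul_apply, h0, h5, h6,
        smul_eq_mul, smul_eq_mul]
      ring
  have hcl : IsClosed (J.range : Set L2) := by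
    have : CompleteSpace N := h.isClosed.completeSpace_coe
    exact J.isometry.isClosedEmbedding.isClosed_range
  have hle : J.range ≤ hardy := by
    rintro _ ⟨f, rfl⟩
    exact hJhardy f
  -- `J` intertwines the deflation on `N` with the backward shift: both drop the first coefficient
  -- of the series.
  have hinv : ∀ q ∈ J.range, backShift q ∈ J.range := by
    rintro _ ⟨f, rfl⟩
    refine ⟨⟨_, h.deflate_mem f.2⟩, hext _ _ (hJhardy _) (backShift_mem_hardy _) fun k => ?_⟩
    change inner ℂ _ (J _) = inner ℂ _ (backShift (J f))
    rw [inner_backShift_right (fourierLp_mem_hardy (Int.natCast_nonneg k)), mulZPow_fourierLp,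
      add_comm, ← Nat.cast_succ, hcoeff, hcoeff, pow_succ, mul_apply_eq_comp]
  rcases eq_hardy_or_exists_modelSpace hcl hle hinv with hK | ⟨β, hβ, hK⟩
  · left
    have hsurj : ∀ q ∈ hardy, ∃ f, J f = q := fun q hq => by
      rw [← hK] at hq
      exact hq
    have hg0 : J ⟨g, h.mem⟩ = fourierLp 2 0 := by
      refine hext _ _ (hJhardy _) (fourierLp_mem_hardy le_rfl) fun k => ?_
      rw [hcoeff, inner_fourierLp]
      have hT : deflate backShift g g = 0 := by
        rw [deflate_apply, inner_self_eq_norm_sq_to_K, h.norm_eq]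
        simp
      cases k with
      | zero => simp [h.norm_eq, inner_self_eq_norm_sq_to_K]
      | succ k => rw [pow_succ, mul_apply_eq_comp, hT, map_zero, inner_zero_right, if_neg (by omega)]
    -- Since `J g = 1` and `J (zⁿg) = zⁿ`, the isometry transports `1 ⊥ zⁿ` to `g ⊥ zⁿg`.
    have hmod : ∀ᵐ t ∂haarT, ‖g t‖ = 1 := by
      refine norm_ae_eq_one h.norm_eq fun n hn => ?_
      obtain ⟨f, hf⟩ := hsurj _ (fourierLp_mem_hardy hn.le)
      have h1 : (f : L2) = mulZPow n g := by
        refine Lp.ext ?_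
        filter_upwards [hprod f, coeFn_mulZPow n g,
          coeFn_fourierLp (T := (1 : ℝ)) 2 n] with t h2 h3 h4
        rw [h2, h3, hf, h4, mul_comm]
      have h2 := J.inner_map_map ⟨g, h.mem⟩ f
      rw [hg0, hf, inner_fourierLp, if_neg hn.ne, Submodule.coe_inner, h1] at h2
      exact h2.symm
    refine ⟨⟨h.le_hardy h.mem, hmod⟩, le_antisymm (fun f hf => ?_) ?_⟩
    · exact ⟨_, hJhardy ⟨f, hf⟩, hprod ⟨f, hf⟩⟩
    · rintro f ⟨q, hq, hfq⟩
      obtain ⟨f', rfl⟩ := hsurj q hq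
      have : f = f' := by
        refine Lp.ext ?_
        filter_upwards [hfq, hprod f'] with t h1 h2
        rw [h1, h2]
      rw [this]
      exact f'.2
  · refine Or.inr ⟨β, hβ, fun k hk => ?_, fun f hf => ?_⟩
    · rw [← hK] at hk
      obtain ⟨f, rfl⟩ := hk
      exact ⟨f, f.2, hprod f⟩
    · exact ⟨J ⟨f, hf⟩, hK ▸ ⟨⟨f, hf⟩, rfl⟩, hprod ⟨f, hf⟩⟩

end IsExtremal

/-- A nonzero closed nearly backward shift invariant subspace of `H²` has an extremal vector. -/
theorem exists_isExtremal {N : Submodule ℂ L2} (hcl : IsClosed (N : Set L2)) (hN : N ≤ hardy)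
    (hnear : ∀ f ∈ N, inner ℂ (fourierLp 2 0 : L2) f = 0 → mulZPow (-1) f ∈ N) (hne : N ≠ ⊥) :
    ∃ g, IsExtremal N g ∧ (∃ r : ℝ, 0 < r ∧ inner ℂ (fourierLp 2 0 : L2) g = (r : ℂ)) ∧
      ∀ f ∈ N, inner ℂ (fourierLp 2 0 : L2) f = 0 → inner ℂ f g = 0 := by
  have : CompleteSpace N := hcl.completeSpace_coe
  -- `w` represents evaluation at zero on `N`. Were it zero, all of `N` would vanish there and `N`
  -- would be invariant under `z̄`, hence trivial.
  set w : L2 := N.starProjection (fourierLp 2 0) with hw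
  have hwN : w ∈ N := Submodule.starProjection_apply_mem N _
  have hwf : ∀ f ∈ N, inner ℂ w f = inner ℂ (fourierLp 2 0 : L2) f := fun f hf => by
    rw [hw, Submodule.inner_starProjection_left_eq_right,
      Submodule.starProjection_eq_self_iff.2 hf]
  have hw0 : w ≠ 0 := fun h0 => hne <| by
    refine eq_bot_of_backward_invariant hN fun f hf => hnear f hf ?_
    rw [← hwf f hf, h0, inner_zero_left]
  have hwpos : 0 < ‖w‖ := norm_pos_iff.2 hw0
  have hinner : ∀ f ∈ N, inner ℂ (((‖w‖⁻¹ : ℝ) : ℂ) • w) f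
      = ((‖w‖⁻¹ : ℝ) : ℂ) * inner ℂ (fourierLp 2 0 : L2) f := fun f hf => by
    rw [inner_smul_left, Complex.conj_ofReal, hwf f hf]
  have hc : ((‖w‖⁻¹ : ℝ) : ℂ) ≠ 0 := by
    exact_mod_cast (inv_pos.2 hwpos).ne'
  refine ⟨((‖w‖⁻¹ : ℝ) : ℂ) • w, ⟨hcl, hN, hnear, N.smul_mem _ hwN, ?_, fun f hf h0 => ?_⟩,
    ⟨‖w‖, hwpos, ?_⟩, fun f hf h0 => ?_⟩
  · rw [norm_smul, Complex.norm_real, norm_inv, norm_norm, inv_mul_cancel₀ hwpos.ne']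
  · rw [hinner f hf] at h0
    exact (mul_eq_zero.1 h0).resolve_left hc
  · rw [inner_smul_right, ← hwf w hwN, inner_self_eq_norm_sq_to_K]
    have : (‖w‖ : ℂ) ≠ 0 := by exact_mod_cast hwpos.ne'
    push_cast
    field_simp
    rfl
  · rw [← inner_conj_symm, hinner f hf, h0, mul_zero, map_zero]

end Hitt

/-! ### Near invariance under `U_θ^*` as division by `z`. -/

section DualShiftAction

variable {θ : L2}

/-- If `f` and `z̄f` are both orthogonal to `K_θ`, then `U_θ (z̄f) = f` and `U_θ^* f = z̄f`. -/
theorem dualShift_mulZPow_neg_one {f : L2} (hf : f ∈ (modelSpace θ)ᗮ)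
    (hzf : mulZPow (-1) f ∈ (modelSpace θ)ᗮ) : dualShift θ ⟨_, hzf⟩ = ⟨f, hf⟩ := by
  have h1 : mulZ (mulZPow (-1) f) = f := by
    rw [mulZ_eq_mulZPow, mulZPow_mulZPow, add_neg_cancel, mulZPow_zero]
  change (modelSpace θ)ᗮ.orthogonalProjectionOnto (mulZ (mulZPow (-1) f)) = _
  rw [h1]
  exact Submodule.orthogonalProjectionOnto_mem_subspace_eq_self ⟨f, hf⟩

theorem adjoint_dualShift_apply {f : L2} (hf : f ∈ (modelSpace θ)ᗮ)
    (hzf : mulZPow (-1) f ∈ (modelSpace θ)ᗮ) :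
    ContinuousLinearMap.adjoint (dualShift θ) ⟨f, hf⟩ = ⟨_, hzf⟩ := by
  refine ext_inner_right ℂ fun v => ?_
  rw [ContinuousLinearMap.adjoint_inner_left]
  change inner ℂ (⟨f, hf⟩ : (modelSpace θ)ᗮ)
    ((modelSpace θ)ᗮ.orthogonalProjectionOnto (mulZ (v : L2))) = _
  rw [Submodule.inner_orthogonalProjectionOnto_eq_of_mem_left, mulZ_eq_mulZPow,
    Submodule.coe_inner, inner_mulZPow_left, neg_neg]

/-- If `z̄f ∈ K_θ^⊥`, then `f = U_θ (z̄f)` lies in the range of `U_θ`, and `U_θ^*` sends it to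
`z̄f`. -/
theorem IsNearlyInvariant.mulZPow_neg_one_mem {M : Submodule ℂ (modelSpace θ)ᗮ}
    (hM : IsNearlyInvariant (ContinuousLinearMap.adjoint (dualShift θ)) M) {f : L2}
    (hf : f ∈ M.map (modelSpace θ)ᗮ.subtype) (hzf : mulZPow (-1) f ∈ (modelSpace θ)ᗮ) :
    mulZPow (-1) f ∈ M.map (modelSpace θ)ᗮ.subtype := by
  obtain ⟨⟨f, hf'⟩, hfM, rfl⟩ := hf
  refine ⟨⟨_, hzf⟩, ?_, rfl⟩
  have h1 := hM.2 ⟨f, hf'⟩ hfM (by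
    rw [ContinuousLinearMap.adjoint_adjoint]
    exact ⟨_, dualShift_mulZPow_neg_one hf' hzf⟩)
  rwa [adjoint_dualShift_apply hf' hzf] at h1

/-- Testing against `zⁿ` with `n ≥ 0` suffices: `⟨zⁿ, v⟩` is the conjugate of the coefficient of `v̄
∈ zH²` at `-n`, which vanishes. -/
theorem inner_eq_zero_of_mem_conjSpace {u v : L2} (hu : u ∈ hardy)
    (hv : v ∈ conjSpace hardyZero) : inner ℂ u v = 0 := by
  have hle : hardy ≤ (Submodule.span ℂ {v})ᗮ := by
    refine hardy_le (Submodule.isClosed_orthogonal _) fun n hn => ?_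
    rw [Submodule.mem_orthogonal_singleton_iff_inner_left]
    have h1 := mem_hardyZero_iff.1 (mem_conjSpace_iff.1 hv)
    have h2 := mem_hardy_iff.1 h1 (-n - 1) (by omega)
    rw [inner_fourierLp_mulZPow, L2.inner_def] at h2
    have h3 := congrArg conj h2
    rw [map_zero, ← integral_conj] at h3
    rw [L2.inner_def, ← h3]
    refine integral_congr_ae ?_
    filter_upwards [Lp.coeFn_star v, coeFn_fourierLp (T := (1 : ℝ)) 2 n,
      coeFn_fourierLp (T := (1 : ℝ)) 2 (-n - 1 - -1)] with t h4 h5 h6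
    rw [RCLike.inner_apply, RCLike.inner_apply, h4, h5, h6, Pi.star_apply, RCLike.star_def,
      show -n - 1 - -1 = -n by ring, fourier_neg, map_mul, Complex.conj_conj, Complex.conj_conj]
  exact Submodule.mem_orthogonal_singleton_iff_inner_left.1 (hle hu)

theorem conjSpace_hardyZero_le : conjSpace hardyZero ≤ (modelSpace θ)ᗮ := fun _ hv =>
  (Submodule.mem_orthogonal _ _).2 fun _ hu => inner_eq_zero_of_mem_conjSpace hu.1 hv

theorem mulSpace_hardy_le_orthogonal : mulSpace θ hardy ≤ (modelSpace θ)ᗮ := fun v hv =>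
  (Submodule.mem_orthogonal _ _).2 fun u hu => by
    rw [← inner_conj_symm, (Submodule.mem_orthogonal _ _).1 hu.2 v hv, map_zero]

theorem mulZPow_neg_one_mem_conjSpace {f : L2} (hf : f ∈ conjSpace hardyZero) :
    mulZPow (-1) f ∈ conjSpace hardyZero := by
  rw [mem_conjSpace_iff, mem_hardyZero_iff] at hf ⊢
  have := mulZPow_mem_hardy zero_le_one hf
  rwa [star_mulZPow, mulZPow_mulZPow, ← add_comm, ← mulZPow_mulZPow]

end DualShiftAction

/-! ### Classification of the two summands. -/

section Splitting

variable {θ : L2}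

theorem mulSpace_hardy_le_hardy (hθ : IsInner θ) : mulSpace θ hardy ≤ hardy :=
  mulSpace_hardy_le isClosed_hardy (fun _ hf => mulZPow_mem_hardy zero_le_one hf) hθ.1 hθ.2

theorem mem_left_of_mem_sup (hθ : IsInner θ) {Mm Mp : Submodule ℂ L2}
    (hMm : Mm ≤ conjSpace hardyZero) (hMp : Mp ≤ mulSpace θ hardy) {f : L2}
    (hf : f ∈ Mm ⊔ Mp) (hf' : f ∈ conjSpace hardyZero) : f ∈ Mm := by
  obtain ⟨a, ha, b, hb, rfl⟩ := Submodule.mem_sup.1 hf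
  have h1 : b ∈ conjSpace hardyZero := by
    simpa using (conjSpace hardyZero).sub_mem hf' (hMm ha)
  have h2 := inner_eq_zero_of_mem_conjSpace (mulSpace_hardy_le_hardy hθ (hMp hb)) h1
  rw [inner_self_eq_zero] at h2
  rwa [h2, add_zero]

theorem mem_right_of_mem_sup (hθ : IsInner θ) {Mm Mp : Submodule ℂ L2}
    (hMm : Mm ≤ conjSpace hardyZero) (hMp : Mp ≤ mulSpace θ hardy) {f : L2}
    (hf : f ∈ Mm ⊔ Mp) (hf' : f ∈ mulSpace θ hardy) : f ∈ Mp := by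
  obtain ⟨a, ha, b, hb, rfl⟩ := Submodule.mem_sup.1 hf
  have h1 : a ∈ mulSpace θ hardy := by
    simpa using (mulSpace θ hardy).sub_mem hf' (hMp hb)
  have h2 := inner_eq_zero_of_mem_conjSpace (mulSpace_hardy_le_hardy hθ h1) (hMm ha)
  rw [inner_self_eq_zero] at h2
  rwa [h2, zero_add]

/-- The closed subspaces of `conj H₀²` that are invariant under multiplication by `z̄`. -/
theorem eq_bot_or_exists_conjSpace {N : Submodule ℂ L2} (hcl : IsClosed (N : Set L2))
    (hN : N ≤ conjSpace hardyZero) (hz : ∀ f ∈ N, mulZPow (-1) f ∈ N) :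
    N = ⊥ ∨ ∃ α : L2, IsInner α ∧ N = conjSpace (mulSpace α hardyZero) := by
  have hle : conjSpace N ≤ hardyZero := fun f hf => by
    have := mem_conjSpace_iff.1 (hN (mem_conjSpace_iff.1 hf))
    rwa [star_star] at this
  have hinv : ∀ f ∈ conjSpace N, mulZPow 1 f ∈ conjSpace N := fun f hf => by
    rw [mem_conjSpace_iff] at hf ⊢
    rw [star_mulZPow]
    exact hz _ hf
  rcases eq_bot_or_exists_isInner (isClosed_conjSpace hcl) (hle.trans hardyZero_le_hardy) hinv
    with hbot | ⟨u, hu, huN, hNu⟩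
  · left
    rw [eq_bot_iff]
    intro f hf
    have h1 : star f ∈ conjSpace N := by rwa [mem_conjSpace_iff, star_star]
    rw [hbot, Submodule.mem_bot] at h1
    rw [Submodule.mem_bot]
    refine Lp.ext ?_
    have h2 := Lp.coeFn_star f
    rw [h1] at h2
    filter_upwards [h2, Lp.coeFn_zero ℂ 2 haarT] with t h3 h4
    rw [h4, Pi.zero_apply, Pi.star_apply] at h3
    rw [h4, Pi.zero_apply]
    exact star_eq_zero.1 h3.symm
  · right
    have hα : ∀ᵐ t ∂haarT, ‖mulZPow (-1) u t‖ = 1 := by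
      filter_upwards [hu.2, coeFn_mulZPow (-1) u] with t h1 h2
      rw [h2, norm_mul, h1, fourier_apply, Circle.norm_coe, one_mul]
    have hmul : ∀ f, mulBy (mulZPow (-1) u) f = mulBy u (mulZPow (-1) f) := fun f => by
      refine Lp.ext ?_
      filter_upwards [coeFn_mulBy hα f, coeFn_mulZPow (-1) u, coeFn_mulZPow (-1) f,
        coeFn_mulBy hu.2 (mulZPow (-1) f)] with t h1 h2 h3 h4
      rw [h1, h2, h4, h3]
      ring
    -- Beurling's inner function `u` lies in `zH²`, so `α = z̄u` is inner and `uH² = αH₀²`.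
    refine ⟨mulZPow (-1) u, ⟨mem_hardyZero_iff.1 (hle huN), hα⟩, ?_⟩
    rw [← conjSpace_conjSpace N, hNu]
    congr 1
    ext f
    constructor
    · intro hf
      rw [mem_mulSpace_iff hu.2] at hf
      have h1 : mulZPow 1 (mulBy (star u) f) ∈ hardyZero := by
        rw [mem_hardyZero_iff, mulZPow_mulZPow, neg_add_cancel, mulZPow_zero]
        exact hf
      have h2 := mulBy_mem_mulSpace hα h1
      rwa [hmul, mulZPow_mulZPow, neg_add_cancel, mulZPow_zero, mulBy_mulBy_star hu.2] at h2
    · intro hf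
      rw [mem_mulSpace_iff hα] at hf
      have h1 := mulBy_mem_mulSpace hu.2 (mem_hardyZero_iff.1 hf)
      rwa [← hmul, mulBy_mulBy_star hα] at h1

/-- The description of the part of a nearly invariant subspace that lies in `θH²`. -/
theorem mulSpace_part_classification (hθ : IsInner θ) {Mm Mp : Submodule ℂ L2}
    (hcl : IsClosed (Mp : Set L2)) (hMm : Mm ≤ conjSpace hardyZero)
    (hMp : Mp ≤ mulSpace θ hardy)
    (hz : ∀ f ∈ Mp, mulZPow (-1) f ∈ mulSpace θ hardy → mulZPow (-1) f ∈ Mp) :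
    Mp = ⊥ ∨
      (∃ β G : L2, IsInner β ∧ G ∈ mulSpace θ hardy ∧ G ∈ Mm ⊔ Mp ∧ ‖G‖ = 1 ∧
        (∀ f ∈ Mm ⊔ Mp, inner ℂ θ f = 0 → inner ℂ f G = 0) ∧
        (∃ r : ℝ, 0 < r ∧ inner ℂ θ G = (r : ℂ)) ∧
        (∀ k ∈ modelSpace β, MemLp (fun t => G t * k t) 2 haarT) ∧
        Mp = mulSpace G (modelSpace β)) ∨
      ∃ γ : L2, IsInner γ ∧ valueAtZero γ ≠ 0 ∧ Mp = mulSpace γ (mulSpace θ hardy) := by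
  -- `N = θ̄M₊`. Dividing by `θ` turns the condition `z̄f ∈ θH²` into vanishing at zero.
  obtain ⟨N, hN⟩ : ∃ N : Submodule ℂ L2, N = Mp.comap (mulBy θ).toLinearMap := ⟨_, rfl⟩
  have hmem : ∀ f, f ∈ N ↔ mulBy θ f ∈ Mp := fun f => by rw [hN]; exact Iff.rfl
  have hmem' : ∀ f, f ∈ Mp ↔ mulBy (star θ) f ∈ N := fun f => by
    rw [hmem, mulBy_mulBy_star hθ.2]
  have hNcl : IsClosed (N : Set L2) := hN ▸ isClosed_comap hcl _
  have hNle : N ≤ hardy := fun f hf => by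
    have := (mem_mulSpace_iff hθ.2).1 (hMp ((hmem f).1 hf))
    rwa [mulBy_star_mulBy hθ.2] at this
  have hnear : ∀ f ∈ N, inner ℂ (fourierLp 2 0 : L2) f = 0 → mulZPow (-1) f ∈ N := by
    intro f hf h0
    rw [hmem, mulBy_mulZPow hθ.2]
    refine hz _ ((hmem f).1 hf) ?_
    rw [← mulBy_mulZPow hθ.2]
    exact mulBy_mem_mulSpace hθ.2 (mulZPow_neg_one_mem_hardy (hNle hf) h0)
  by_cases hne : N = ⊥
  · left
    rw [eq_bot_iff]
    intro f hf
    rw [hmem', hne, Submodule.mem_bot] at hf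
    rw [Submodule.mem_bot, ← mulBy_mulBy_star hθ.2 f, hf, map_zero]
  right
  obtain ⟨g, hg, ⟨r, hr, hgr⟩, hgorth⟩ := exists_isExtremal hNcl hNle hnear hne
  have hprod : ∀ {f k : L2}, (∀ᵐ t ∂haarT, f t = g t * k t) →
      ∀ᵐ t ∂haarT, mulBy θ f t = mulBy θ g t * k t := fun {f k} hf => by
    filter_upwards [hf, coeFn_mulBy hθ.2 f, coeFn_mulBy hθ.2 g] with t h1 h2 h3
    rw [h2, h3, h1, mul_assoc]
  rcases hg.isInner_or_exists_modelSpace with ⟨hginn, hNg⟩ | ⟨β, hβ, hβN, hNβ⟩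
  · refine Or.inr ⟨g, hginn, ?_, ?_⟩
    · rw [valueAtZero, fourierCoeff_eq_inner, hgr]
      exact_mod_cast hr.ne'
    · have hcomm : ∀ f, mulBy (star g) (mulBy (star θ) f) = mulBy (star θ) (mulBy (star g) f) := by
        intro f
        have hθ' := norm_star_ae hθ.2
        have hg' := norm_star_ae hginn.2
        refine Lp.ext ?_
        filter_upwards [coeFn_mulBy hg' (mulBy (star θ) f), coeFn_mulBy hθ' f,
          coeFn_mulBy hθ' (mulBy (star g) f), coeFn_mulBy hg' f] with t h1 h2 h3 h4
        rw [h1, h2, h3, h4]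
        ring
      ext f
      rw [hmem', hNg, mem_mulSpace_iff hginn.2, mem_mulSpace_iff hginn.2, mem_mulSpace_iff hθ.2,
        hcomm]
  -- With `θ = θ·1`, pairing `θf` with `θ` is evaluation of `f` at zero, so the extremal properties
  -- of `g` pass to `G = θg`.
  · have hθe : mulBy θ (fourierLp 2 0) = θ := by rw [mulBy_fourierLp hθ.2, mulZPow_zero]
    have hGMp : mulBy θ g ∈ Mp := (hmem g).1 hg.mem
    refine Or.inl ⟨β, mulBy θ g, hβ, hMp hGMp, Submodule.mem_sup_right hGMp, ?_, ?_,
      ⟨r, hr, ?_⟩, ?_, le_antisymm ?_ ?_⟩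
    · rw [norm_mulBy hθ.2, hg.norm_eq]
    · intro f hf hf0
      obtain ⟨a, ha, b, hb, rfl⟩ := Submodule.mem_sup.1 hf
      rw [inner_add_right, inner_eq_zero_of_mem_conjSpace hθ.1 (hMm ha), zero_add] at hf0
      have h1 : inner ℂ a (mulBy θ g) = 0 := by
        rw [← inner_conj_symm, inner_eq_zero_of_mem_conjSpace
          (mulSpace_hardy_le_hardy hθ (hMp hGMp)) (hMm ha), map_zero]
      rw [← mulBy_mulBy_star hθ.2 b] at hf0 ⊢
      nth_rewrite 1 [← hθe] at hf0
      rw [inner_mulBy_mulBy hθ.2] at hf0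
      rw [inner_add_left, h1, inner_mulBy_mulBy hθ.2, zero_add]
      exact hgorth _ ((hmem' b).1 hb) hf0
    · nth_rewrite 1 [← hθe]
      rw [inner_mulBy_mulBy hθ.2, hgr]
    · intro k hk
      obtain ⟨f, -, hf⟩ := hβN k hk
      exact (Lp.memLp (mulBy θ f)).ae_eq (hprod hf)
    · intro f hf
      obtain ⟨k, hk, hfk⟩ := hNβ _ ((hmem' f).1 hf)
      refine ⟨k, hk, ?_⟩
      have := hprod hfk
      rwa [mulBy_mulBy_star hθ.2] at this
    · rintro f ⟨k, hk, hfk⟩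
      obtain ⟨f', hf', hfk'⟩ := hβN k hk
      have : f = mulBy θ f' := by
        refine Lp.ext ?_
        filter_upwards [hfk, hprod hfk'] with t h1 h2
        rw [h1, h2]
      rw [this]
      exact (hmem f').1 hf'

end Splitting

end DualShift

end

/-! ### The classification theorem. -/

theorem corollary3p6 (θ : DualShift.L2) (hθ : DualShift.IsInner θ)
    (hθ0 : DualShift.valueAtZero θ = 0)
    (M : Submodule ℂ (DualShift.modelSpace θ)ᗮ) (Mm Mp : Submodule ℂ DualShift.L2)
    (hMm_closed : IsClosed (Mm : Set DualShift.L2))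
    (hMp_closed : IsClosed (Mp : Set DualShift.L2))
    (hMm : Mm ≤ DualShift.conjSpace DualShift.hardyZero)
    (hMp : Mp ≤ DualShift.mulSpace θ DualShift.hardy)
    (hM : M.map (DualShift.modelSpace θ)ᗮ.subtype = Mm ⊔ Mp)
    (hnear : DualShift.IsNearlyInvariant
      (ContinuousLinearMap.adjoint (DualShift.dualShift θ)) M) :
    (Mm = ⊥ ∨ Mm = DualShift.conjSpace DualShift.hardyZero ∨
      ∃ α : DualShift.L2, DualShift.IsInner α ∧
        Mm = DualShift.conjSpace (DualShift.mulSpace α DualShift.hardyZero)) ∧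
    (Mp = ⊥ ∨ Mp = DualShift.mulSpace θ DualShift.hardy ∨
      (∃ β G : DualShift.L2, DualShift.IsInner β ∧
        G ∈ DualShift.mulSpace θ DualShift.hardy ∧
        -- `G` is the unit vector of `M ⊖ (M ∩ {θ}^⊥)` with `⟨G, θ⟩ > 0`
        G ∈ Mm ⊔ Mp ∧ ‖G‖ = 1 ∧
        (∀ f ∈ Mm ⊔ Mp, inner ℂ θ f = 0 → inner ℂ f G = 0) ∧
        (∃ r : ℝ, 0 < r ∧ inner ℂ θ G = (r : ℂ)) ∧
        -- `M₊ = G K_β`, all the products being square integrable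
        (∀ k ∈ DualShift.modelSpace β,
          MeasureTheory.MemLp (fun t => G t * k t) 2 DualShift.haarT) ∧
        Mp = DualShift.mulSpace G (DualShift.modelSpace β)) ∨
      ∃ γ : DualShift.L2, DualShift.IsInner γ ∧ DualShift.valueAtZero γ ≠ 0 ∧
        Mp = DualShift.mulSpace γ (DualShift.mulSpace θ DualShift.hardy)) :=by
  have hinv : ∀ f ∈ Mm ⊔ Mp, DualShift.mulZPow (-1) f ∈ (DualShift.modelSpace θ)ᗮ →
      DualShift.mulZPow (-1) f ∈ Mm ⊔ Mp := by
    rw [← hM]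
    exact fun f hf hzf => hnear.mulZPow_neg_one_mem hf hzf
  refine ⟨?_, ?_⟩
  · have h1 := DualShift.eq_bot_or_exists_conjSpace hMm_closed hMm fun f hf => by
      have h2 := DualShift.mulZPow_neg_one_mem_conjSpace (hMm hf)
      exact DualShift.mem_left_of_mem_sup hθ hMm hMp (hinv f (Submodule.mem_sup_left hf)
        (DualShift.conjSpace_hardyZero_le h2)) h2
    -- The full space `conj H₀²` needs no separate branch, being the case `α = 1`; likewise `θH²`
    -- below is the case `γ = 1`.
    exact h1.imp_right Or.inr
  · have h1 := DualShift.mulSpace_part_classification hθ hMp_closed hMm hMp fun f hf hzf =>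
      DualShift.mem_right_of_mem_sup hθ hMm hMp (hinv f (Submodule.mem_sup_right hf)
        (DualShift.mulSpace_hardy_le_orthogonal hzf)) hzf
    exact h1.imp_right Or.inr
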